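/- Notation. For a complex $p\times p$ matrix $M$ let $s_m=\{(j,k):|j-k|=p-m\}$ ($1\le m\le p$), $g_\ell=s_1\cup\dots\cup s_\ell$ ($g_0=\emptyset$), let $\|M_I\|_2$ be the Euclidean norm of the entries of $M$ with positions in $I$, and let $w_{\ell,m}=\sqrt{2\ell}/(\ell-m+1)$ and $\|M\|_{2,1}^*=\sum_{\ell=1}^{p-1}\big(\sum_{m=1}^{\ell}w_{\ell,m}^2\|M_{s_m}\|_2^2\big)^{1/2}$. For a matrix $S$, a real number $\hat\sigma^2$ and $\mu\ge 0$ let $$\hat\Sigma=\arg\min_{M\in\mathbb C^{p\times p}}\Big\{\tfrac12\|M-(S+\hat\sigma^2 I)\|_F^2+\mu\|M\|_{2,1}^*\Big\}.$$ Theorem. Let $C,S_0,\kappa_0,\kappa_1,c'>0$ and $\eta\ge 0$. There are constants $c_1>0$ and $x_0>0$, depending only on these, and for every $x>0$ a constant $C'>0$, depending only on these and on $x$, such that the following holds for all integers $p,K\ge 1$. Let $x_1,\dots,x_K$ be i.i.d. copies of a random vector $\mathbf x=(X_1,\dots,X_p)^T$ in $\mathbb C^p$ with finite second moments, and let $S=\frac1K\sum_{i=1}^K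 x_ix_i^H$ be their sample covariance matrix (SCM). Suppose: (a) $\mathbb E[\mathbf x]=0$ and $\mathbb E[\mathbf x\mathbf x^H]=\Sigma$; for every $j$ and all $t\in\mathbb R$, $\mathbb E\exp(tY)\le\exp(Ct^2)$ for $Y$ the real part and for $Y$ the imaginary part of $X_j/\sqrt{\Sigma_{jj}}$ (with $0/0=0$); and $\max_{j,k}|\Sigma_{jk}|\le S_0$. (b) $\kappa_0\log K\le\log p\le\kappa_1K$. (c) $\Sigma$ is banded with bandsize $L$ and satisfies the banded-SNR condition: for $B=p-1-L\in\{0,\dots,p-1\}$ and some $M_1,M_2\ge 0$ with $M_1\le\eta L\sqrt{\log p/K}$ one has $\|\Sigma_{g_B}\|_2\le M_1$, $\|\Sigma_{s_{B+1}}\|_2>M_2$, and $\|\Sigma_{s_\ell}\|_2/\sqrt{2\ell}\ge c'$ for all $B<\ell\le p-1$. (d) $\lambda_{\min}(\Sigma)=\sigma^2\ge C'L\sqrt{\log p/K}$. Let $\mathcal A_x$ be the event $\max_{j,k}|S_{jk}-\Sigma_{jk}|\le x\sqrt{\log p/K}$, and let $\mathcal G$ be the event that for every real number $\hat\sigma^2$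 (in particular for any noise power estimate computed from the data) the estimator $\hat\Sigma$ with input $S$ and $\mu=2x\sqrt{\log p/K}$ exists, is unique and Hermitian, and satisfies $\lambda_{\min}(\hat\Sigma)\ge\hat\sigma^2$. Then $\mathcal G$ holds with probability at least $1-c_1/p$ on $\mathcal A_x$, that is, $\mathbb P(\mathcal A_x\setminus\mathcal G)\le\frac{c_1}{p}\,\mathbb P(\mathcal A_x)$; moreover, if $x\ge x_0$, then $\mathbb P(\mathcal A_x\cap\mathcal G)\ge 1-c_1/p$. (If $\mathcal A_x\setminus\mathcal G$ or $(\mathcal A_x\cap\mathcal G)^c$ is not measurable, its probability is read as outer measure.) -/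

import Mathlib

open MeasureTheory ProbabilityTheory
open scoped NNReal ENNReal

namespace Banding

/-- The index set `s_m = {(j, k) : |j - k| = p - m}`; it is numbered from the corners
(`m = 1`) towards the main diagonal (`m = p`). -/
def sIdx (p m : ℕ) : Finset (Fin p × Fin p) :=
  Finset.univ.filter fun jk => ((jk.1 : ℤ) - (jk.2 : ℤ)).natAbs + m = p

/-- The index set `g_ℓ = s_1 ∪ ⋯ ∪ s_ℓ`. -/
def gIdx (p l : ℕ) : Finset (Fin p × Fin p) :=
  (Finset.Icc 1 l).biUnion fun m => sIdx p m

/-- The Euclidean norm of the entries of `M` whose positions lie in `I`. -/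
noncomputable def entryNorm {p : ℕ} (I : Finset (Fin p × Fin p))
    (M : Matrix (Fin p) (Fin p) ℂ) : ℝ :=
  Real.sqrt (∑ jk ∈ I, ‖M jk.1 jk.2‖ ^ 2)

/-- The weights `w_{ℓ,m} = √(2ℓ) / (ℓ - m + 1)`, for `1 ≤ m ≤ ℓ`. -/
noncomputable def weight (l m : ℕ) : ℝ :=
  Real.sqrt (2 * (l : ℝ)) / ((l : ℝ) - (m : ℝ) + 1)

/-- The hierarchical group lasso penalty
`∑_{ℓ=1}^{p-1} (∑_{m=1}^{ℓ} w_{ℓ,m}² ‖M_{s_m}‖₂²)^{1/2}`. -/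
noncomputable def penalty {p : ℕ} (M : Matrix (Fin p) (Fin p) ℂ) : ℝ :=
  ∑ l ∈ Finset.Icc 1 (p - 1),
    Real.sqrt (∑ m ∈ Finset.Icc 1 l, weight l m ^ 2 * entryNorm (sIdx p m) M ^ 2)

/-- The objective `½ ‖M - (S + τ I)‖_F² + μ · penalty M`. -/
noncomputable def objective {p : ℕ} (S : Matrix (Fin p) (Fin p) ℂ) (τ μ : ℝ)
    (M : Matrix (Fin p) (Fin p) ℂ) : ℝ :=
  (1 / 2) * entryNorm Finset.univ (M - (S + (τ : ℂ) • (1 : Matrix (Fin p) (Fin p) ℂ))) ^ 2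
    + μ * penalty M

/-- `M` minimizes the objective over all complex `p × p` matrices. -/
def IsBandedEstimate {p : ℕ} (S : Matrix (Fin p) (Fin p) ℂ) (τ μ : ℝ)
    (M : Matrix (Fin p) (Fin p) ℂ) : Prop :=
  ∀ N : Matrix (Fin p) (Fin p) ℂ, objective S τ μ M ≤ objective S τ μ N

/-- `r` is the smallest eigenvalue of the (Hermitian) matrix `A`. -/
def IsMinEigenvalue {p : ℕ} (A : Matrix (Fin p) (Fin p) ℂ) (r : ℝ) : Prop :=
  IsLeast {t : ℝ | (t : ℂ) ∈ spectrum ℂ A} r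

/-- The sample covariance matrix `(1/K) ∑ᵢ xᵢ xᵢᴴ`. -/
noncomputable def scm {p K : ℕ} (x : Fin K → Fin p → ℂ) : Matrix (Fin p) (Fin p) ℂ :=
  (K : ℂ)⁻¹ • ∑ i, Matrix.vecMulVec (x i) (star (x i))

/-- The law `ν` of a random vector in `ℂ^p` has mean zero, covariance matrix `Cov`, entries of
the covariance bounded by `S₀`, and marginally sub-Gaussian normalized coordinates: for `Y` the
real or the imaginary part of `x_j / √Cov_{jj}`, `𝔼 exp(tY) ≤ exp(C t²)` for all real `t`. -/
structure SubGaussianModel {p : ℕ} (ν : Measure (Fin p → ℂ))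
    (Cov : Matrix (Fin p) (Fin p) ℂ) (C : ℝ≥0) (S₀ : ℝ) : Prop where
  memLp : ∀ j, MemLp (fun v : Fin p → ℂ => v j) 2 ν
  mean : ∀ j, ∫ v, v j ∂ν = 0
  cov : ∀ j k, ∫ v, v j * star (v k) ∂ν = Cov j k
  subG_re : ∀ j, HasSubgaussianMGF
    (fun v : Fin p → ℂ => (v j).re / Real.sqrt (Cov j j).re) (2 * C) ν
  subG_im : ∀ j, HasSubgaussianMGF
    (fun v : Fin p → ℂ => (v j).im / Real.sqrt (Cov j j).re) (2 * C) ν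
  bound : ∀ j k, ‖Cov j k‖ ≤ S₀

/-- The banded signal-to-noise condition with index `B`: the entries on `g_B` (outside the band)
have norm at most `M₁`, the entries on `s_{B+1}` have norm larger than `M₂`, and each subdiagonal
pair `s_ℓ` inside the band, `B < ℓ ≤ p - 1`, satisfies `‖Cov_{s_ℓ}‖₂ / √(2ℓ) ≥ c'`. -/
structure BandedSNR {p : ℕ} (Cov : Matrix (Fin p) (Fin p) ℂ) (B : ℕ) (M₁ M₂ c' : ℝ) :
    Prop where
  outside : entryNorm (gIdx p B) Cov ≤ M₁
  edge : M₂ < entryNorm (sIdx p (B + 1)) Cov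
  signal : ∀ l, B < l → l < p → c' ≤ entryNorm (sIdx p l) Cov / Real.sqrt (2 * (l : ℝ))

/-- The rate `√(log p / K)`. -/
noncomputable def rate (p K : ℕ) : ℝ := Real.sqrt (Real.log p / K)

/-- The set `𝒜_x` of matrices `S` with `max_{j,k} |S_{jk} - Cov_{jk}| ≤ x √(log p / K)`. -/
def setA {p : ℕ} (K : ℕ) (Cov : Matrix (Fin p) (Fin p) ℂ) (x : ℝ) :
    Set (Matrix (Fin p) (Fin p) ℂ) :=
  {S | ∀ j k, ‖S j k - Cov j k‖ ≤ x * rate p K}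

/-- The set of matrices `S` such that, for every real number `τ` in the role of the noise power
estimate, the estimator with input `S`, noise power estimate `τ` and regularization parameter `μ`
exists, is unique and Hermitian, and has smallest eigenvalue at least `τ`. -/
def goodSet {p : ℕ} (μ : ℝ) : Set (Matrix (Fin p) (Fin p) ℂ) :=
  {S | ∀ τ : ℝ, (∃! M, IsBandedEstimate S τ μ M) ∧
    ∀ M, IsBandedEstimate S τ μ M → M.IsHermitian ∧ ∃ r, IsMinEigenvalue M r ∧ τ ≤ r}

end Banding

/-! The inclusion `A ⊆ G` is deterministic, so `A \ G` is empty, and probability enters only to show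
that `A` is likely when `x` is large.

No group of the penalty meets the diagonal, so subtracting `τ I` reduces everything to `τ = 0`,
where the minimizer `T` must be shown positive semidefinite. Strict convexity gives uniqueness, and
invariance under conjugate transposition then makes `T` Hermitian. It remains to compare `T` with
`Cov`, with `δ = x * rate` and `μ = 2δ`. Outside the band, zeroing `T` there saves at least `μ`
times the ℓ¹ norm of the deleted entries, which absorbs the noise; hence `‖T‖ ≤ 2‖Cov‖` on `g_B`
(`entryNorm_outside_le`). Inside the band, the signal condition keeps every subdiagonal pair nonzero
(`entryNorm_sIdx_pos`). The penalty is therefore differentiable there, and stationarity gives an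
entrywise relative shrinkage of order `μ` (`estimate_inBand`). A Schur test on the band and the
Frobenius norm off it bound the quadratic form of `T - Cov` by a multiple of `L * rate`, which `σ²`
dominates (`estimate_posSemidef`).

For the probability, products of sub-Gaussian coordinates are sub-exponential. A Chernoff bound with
a parameter proportional to `rate` gives a tail `p⁻³` for each of `4p²` events, whence `c₁ = 4`
(`measure_compl_setA_le`). -/

namespace Banding

/-! ### Convex analysis of the overlapping group lasso. -/

section GroupLasso

variable {ι : Type*} [Fintype ι]

/-- The weighted Euclidean norm `(∑ᵢ cᵢ |Tᵢ|²)^{1/2}`. -/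
noncomputable def wnorm (c : ι → ℝ) (T : ι → ℂ) : ℝ :=
  Real.sqrt (∑ i, c i * ‖T i‖ ^ 2)

lemma wnorm_nonneg (c : ι → ℝ) (T : ι → ℂ) : 0 ≤ wnorm c T := Real.sqrt_nonneg _

lemma wnorm_sq {c : ι → ℝ} (hc : ∀ i, 0 ≤ c i) (T : ι → ℂ) :
    wnorm c T ^ 2 = ∑ i, c i * ‖T i‖ ^ 2 :=
  Real.sq_sqrt (Finset.sum_nonneg fun i _ => mul_nonneg (hc i) (sq_nonneg _))

lemma wnorm_eq_norm {c : ι → ℝ} (hc : ∀ i, 0 ≤ c i) (T : ι → ℂ) :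
    wnorm c T = ‖WithLp.toLp 2 (fun i => (Real.sqrt (c i) : ℂ) * T i)‖ := by
  rw [EuclideanSpace.norm_eq, wnorm]
  congr 1
  refine Finset.sum_congr rfl fun i _ => ?_
  simp only [norm_mul, mul_pow, Complex.norm_real, Real.norm_eq_abs, sq_abs]
  rw [Real.sq_sqrt (hc i)]

lemma wnorm_add_le {c : ι → ℝ} (hc : ∀ i, 0 ≤ c i) (T U : ι → ℂ) :
    wnorm c (T + U) ≤ wnorm c T + wnorm c U := by
  rw [wnorm_eq_norm hc, wnorm_eq_norm hc, wnorm_eq_norm hc]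
  refine le_trans (le_of_eq ?_) (norm_add_le _ _)
  congr 1
  ext i
  simp [mul_add]

lemma wnorm_smul (c : ι → ℝ) (t : ℝ) (ht : 0 ≤ t) (T : ι → ℂ) :
    wnorm c (t • T) = t * wnorm c T := by
  unfold wnorm
  rw [← Real.sqrt_sq ht, ← Real.sqrt_mul (sq_nonneg _), Real.sqrt_sq ht]
  congr 1
  rw [Finset.mul_sum]
  refine Finset.sum_congr rfl fun i _ => ?_
  simp only [Pi.smul_apply, norm_smul, Real.norm_eq_abs, mul_pow, sq_abs]
  ring

lemma wnorm_mono {c : ι → ℝ} (hc : ∀ i, 0 ≤ c i) {T U : ι → ℂ} (h : ∀ i, ‖T i‖ ≤ ‖U i‖) :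
    wnorm c T ≤ wnorm c U := by
  refine Real.sqrt_le_sqrt (Finset.sum_le_sum fun i _ => ?_)
  have := h i
  have := hc i
  gcongr

lemma continuous_wnorm (c : ι → ℝ) : Continuous (wnorm c) := by
  unfold wnorm
  fun_prop

/-- The tangent bound for the square root of a quadratic function. -/
lemma wnorm_add_smul_le {c : ι → ℝ} (hc : ∀ i, 0 ≤ c i) {T : ι → ℂ} (hT : 0 < wnorm c T)
    (D : ι → ℂ) (t : ℝ) :
    wnorm c (T + t • D) ≤ wnorm c T + t * ((∑ i, c i * inner ℝ (T i) (D i)) / wnorm c T)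
      + t ^ 2 * ((∑ i, c i * ‖D i‖ ^ 2) / (2 * wnorm c T)) := by
  have h1 : wnorm c (T + t • D) ^ 2 = wnorm c T ^ 2 + 2 * t * (∑ i, c i * inner ℝ (T i) (D i))
      + t ^ 2 * ∑ i, c i * ‖D i‖ ^ 2 := by
    rw [wnorm_sq hc, wnorm_sq hc, Finset.mul_sum, Finset.mul_sum, ← Finset.sum_add_distrib,
      ← Finset.sum_add_distrib]
    refine Finset.sum_congr rfl fun i _ => ?_
    rw [Pi.add_apply, Pi.smul_apply, norm_add_sq_real, inner_smul_right, norm_smul, mul_pow,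
      Real.norm_eq_abs, sq_abs]
    ring
  have h2 : wnorm c (T + t • D) ≤ (wnorm c (T + t • D) ^ 2 + wnorm c T ^ 2) / (2 * wnorm c T) := by
    rw [le_div_iff₀ (by positivity)]
    nlinarith [sq_nonneg (wnorm c (T + t • D) - wnorm c T)]
  refine h2.trans (le_of_eq ?_)
  rw [h1]
  field_simp
  ring

/-- The overlapping group lasso objective `½ ‖T - S‖² + μ ∑_ℓ (∑ᵢ v_{ℓ,i} |Tᵢ|²)^{1/2}`. -/
noncomputable def lassoObj (Λ : Finset ℕ) (v : ℕ → ι → ℝ) (μ : ℝ) (S T : ι → ℂ) : ℝ :=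
  (1 / 2) * ∑ i, ‖T i - S i‖ ^ 2 + μ * ∑ l ∈ Λ, wnorm (v l) T

lemma exists_lassoObj_min (Λ : Finset ℕ) (v : ℕ → ι → ℝ) {μ : ℝ} (hμ : 0 ≤ μ) (S : ι → ℂ) :
    ∃ T, ∀ N, lassoObj Λ v μ S T ≤ lassoObj Λ v μ S N := by
  have hcont : Continuous (lassoObj Λ v μ S) := by
    unfold lassoObj
    have h : Continuous fun T : ι → ℂ => ∑ l ∈ Λ, wnorm (v l) T :=
      continuous_finsetSum _ fun l _ => continuous_wnorm _
    fun_prop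
  have hpen : ∀ N, 0 ≤ μ * ∑ l ∈ Λ, wnorm (v l) N := fun N =>
    mul_nonneg hμ (Finset.sum_nonneg fun l _ => wnorm_nonneg _ _)
  set b := lassoObj Λ v μ S 0 with hb
  have hb0 : 0 ≤ b := by
    have := hpen 0
    rw [hb, lassoObj]
    positivity
  obtain ⟨T, hT, hmin⟩ := (isCompact_closedBall S (Real.sqrt (2 * b))).exists_isMinOn
    ⟨S, Metric.mem_closedBall_self (Real.sqrt_nonneg _)⟩ hcont.continuousOn
  -- Sublevel sets are bounded: an objective value at most `b` forces each `|N i - S i|² ≤ 2b`, and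
  -- the norm on `ι → ℂ` is the sup norm.
  have hout : ∀ N, lassoObj Λ v μ S N ≤ b → N ∈ Metric.closedBall S (Real.sqrt (2 * b)) := by
    intro N hN
    rw [mem_closedBall_iff_norm, pi_norm_le_iff_of_nonneg (Real.sqrt_nonneg _)]
    intro i
    refine Real.le_sqrt_of_sq_le ?_
    have h1 : ‖N i - S i‖ ^ 2 ≤ ∑ i, ‖N i - S i‖ ^ 2 :=
      Finset.single_le_sum (f := fun i => ‖N i - S i‖ ^ 2) (fun i _ => sq_nonneg _)
        (Finset.mem_univ i)
    have h2 := hpen N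
    unfold lassoObj at hN
    rw [Pi.sub_apply]
    linarith
  refine ⟨T, fun N => ?_⟩
  by_cases hN : lassoObj Λ v μ S N ≤ b
  · exact hmin (hout N hN)
  · exact (hmin (hout 0 le_rfl)).trans (not_le.1 hN).le

lemma lassoObj_min_unique {Λ : Finset ℕ} {v : ℕ → ι → ℝ} (hv : ∀ l i, 0 ≤ v l i) {μ : ℝ}
    (hμ : 0 ≤ μ) {S T U : ι → ℂ} (hT : ∀ N, lassoObj Λ v μ S T ≤ lassoObj Λ v μ S N)
    (hU : ∀ N, lassoObj Λ v μ S U ≤ lassoObj Λ v μ S N) : T = U := by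
  -- At the midpoint the penalty is at most the average, while the parallelogram law gains a
  -- multiple of `‖T - U‖²` in the quadratic part.
  set N : ι → ℂ := (1 / 2 : ℝ) • T + (1 / 2 : ℝ) • U with hN
  have hpen : ∑ l ∈ Λ, wnorm (v l) N ≤
      (1 / 2) * ∑ l ∈ Λ, wnorm (v l) T + (1 / 2) * ∑ l ∈ Λ, wnorm (v l) U := by
    rw [Finset.mul_sum, Finset.mul_sum, ← Finset.sum_add_distrib]
    refine Finset.sum_le_sum fun l _ => ?_
    rw [← wnorm_smul _ _ (by norm_num), ← wnorm_smul _ _ (by norm_num)]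
    exact wnorm_add_le (hv l) _ _
  have hquad : ∑ i, ‖N i - S i‖ ^ 2 = (1 / 2) * ∑ i, ‖T i - S i‖ ^ 2
      + (1 / 2) * ∑ i, ‖U i - S i‖ ^ 2 - (1 / 4) * ∑ i, ‖T i - U i‖ ^ 2 := by
    rw [Finset.mul_sum, Finset.mul_sum, Finset.mul_sum, ← Finset.sum_add_distrib,
      ← Finset.sum_sub_distrib]
    refine Finset.sum_congr rfl fun i _ => ?_
    have h1 : N i - S i = (1 / 2 : ℝ) • ((T i - S i) + (U i - S i)) := by
      simp only [hN, Pi.add_apply, Pi.smul_apply, Complex.real_smul]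
      push_cast
      ring
    have h2 : T i - U i = (T i - S i) - (U i - S i) := by ring
    rw [h1, h2]
    generalize T i - S i = a
    generalize U i - S i = b
    rw [norm_smul, mul_pow, norm_add_sq_real, norm_sub_sq_real, Real.norm_eq_abs, sq_abs]
    ring
  have h1 := hT N
  have h2 := hU N
  have h3 := mul_le_mul_of_nonneg_left hpen hμ
  unfold lassoObj at h1 h2
  rw [hquad] at h1 h2
  have h4 : ∑ i, ‖T i - U i‖ ^ 2 ≤ 0 := by linarith
  have h5 := (Finset.sum_eq_zero_iff_of_nonneg fun i _ => sq_nonneg ‖T i - U i‖).1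
    (le_antisymm h4 (Finset.sum_nonneg fun i _ => sq_nonneg _))
  funext i
  have := h5 i (Finset.mem_univ i)
  rwa [sq_eq_zero_iff, norm_eq_zero, sub_eq_zero] at this

lemma nonneg_of_forall_quadratic {a b : ℝ} (h : ∀ t : ℝ, 0 < t → 0 ≤ t * a + t ^ 2 * b) :
    0 ≤ a := by
  by_contra ha
  push Not at ha
  have hb : 0 < |b| + 1 := by positivity
  have := h (-a / (2 * (|b| + 1))) (div_pos (neg_pos.2 ha) (by positivity))
  have h1 : 0 ≤ a + (-a / (2 * (|b| + 1))) * b := by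
    have hp : 0 < -a / (2 * (|b| + 1)) := div_pos (neg_pos.2 ha) (by positivity)
    refine nonneg_of_mul_nonneg_right (a := -a / (2 * (|b| + 1))) ?_ hp
    linarith
  have h2 : (-a / (2 * (|b| + 1))) * b ≤ (-a / (2 * (|b| + 1))) * (|b| + 1) := by
    have hp : 0 < -a / (2 * (|b| + 1)) := div_pos (neg_pos.2 ha) (by positivity)
    have := le_abs_self b
    gcongr
    linarith
  have h3 : (-a / (2 * (|b| + 1))) * (|b| + 1) = -a / 2 := by field_simp
  linarith

/-- One-sided quadratic upper bounds on the group norms replace derivatives. This covers both groups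
that are smooth at `T` and vanishing groups, where the norm grows linearly along `D`. -/
lemma lassoObj_first_order {Λ : Finset ℕ} {v : ℕ → ι → ℝ} {μ : ℝ}
    (hμ : 0 ≤ μ) {S T : ι → ℂ} (hT : ∀ N, lassoObj Λ v μ S T ≤ lassoObj Λ v μ S N)
    (D : ι → ℂ) (β γ : ℕ → ℝ)
    (h : ∀ l ∈ Λ, ∀ t : ℝ, 0 < t →
      wnorm (v l) (T + t • D) ≤ wnorm (v l) T + t * β l + t ^ 2 * γ l) :
    0 ≤ ∑ i, inner ℝ (T i - S i) (D i) + μ * ∑ l ∈ Λ, β l := by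
  refine nonneg_of_forall_quadratic
    (b := (1 / 2) * ∑ i, ‖D i‖ ^ 2 + μ * ∑ l ∈ Λ, γ l) fun t ht => ?_
  have h1 := hT (T + t • D)
  have h2 : ∑ i, ‖(T + t • D) i - S i‖ ^ 2 = ∑ i, ‖T i - S i‖ ^ 2
      + 2 * t * ∑ i, inner ℝ (T i - S i) (D i) + t ^ 2 * ∑ i, ‖D i‖ ^ 2 := by
    rw [Finset.mul_sum, Finset.mul_sum, ← Finset.sum_add_distrib, ← Finset.sum_add_distrib]
    refine Finset.sum_congr rfl fun i _ => ?_
    have : (T + t • D) i - S i = (T i - S i) + t • D i := by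
      simp only [Pi.add_apply, Pi.smul_apply]; ring
    rw [this, norm_add_sq_real, inner_smul_right, norm_smul, mul_pow, Real.norm_eq_abs, sq_abs]
    ring
  have h3 : ∑ l ∈ Λ, wnorm (v l) (T + t • D) ≤
      ∑ l ∈ Λ, wnorm (v l) T + t * ∑ l ∈ Λ, β l + t ^ 2 * ∑ l ∈ Λ, γ l := by
    rw [Finset.mul_sum, Finset.mul_sum, ← Finset.sum_add_distrib, ← Finset.sum_add_distrib]
    exact Finset.sum_le_sum fun l hl => h l hl t ht
  have h4 := mul_le_mul_of_nonneg_left h3 hμ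
  unfold lassoObj at h1
  rw [h2] at h1
  nlinarith

/-- The stationarity equation at an entry where every active group is nonzero. -/
lemma lassoObj_stationary {Λ : Finset ℕ} {v : ℕ → ι → ℝ} (hv : ∀ l i, 0 ≤ v l i) {μ : ℝ}
    (hμ : 0 ≤ μ) {S T : ι → ℂ} (hT : ∀ N, lassoObj Λ v μ S T ≤ lassoObj Λ v μ S N) (i : ι)
    (hi : ∀ l ∈ Λ, v l i ≠ 0 → 0 < wnorm (v l) T) :
    S i = (1 + μ * ∑ l ∈ Λ, v l i / wnorm (v l) T : ℝ) • T i := by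
  classical
  -- `R` is the gradient in the entry `i`; moving that entry along `-R` changes the objective at
  -- rate `-‖R‖²`, so minimality forces `R = 0`.
  set R : ℂ := (T i - S i) + (μ * ∑ l ∈ Λ, v l i / wnorm (v l) T) • T i with hR
  have key := lassoObj_first_order hμ hT (Pi.single i (-R))
    (fun l => v l i / wnorm (v l) T * inner ℝ (T i) (-R))
    (fun l => v l i * ‖R‖ ^ 2 / (2 * wnorm (v l) T)) (by
      intro l hl t ht
      by_cases hli : v l i = 0
      · have : wnorm (v l) (T + t • (Pi.single i (-R) : ι → ℂ)) = wnorm (v l) T := by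
          unfold wnorm
          congr 1
          refine Finset.sum_congr rfl fun j _ => ?_
          by_cases hj : j = i
          · subst hj; simp [hli]
          · simp [hj]
        rw [this, hli]
        simp
      · refine (wnorm_add_smul_le (hv l) (hi l hl hli) _ t).trans (le_of_eq ?_)
        have e1 : ∑ j, v l j * inner ℝ (T j) ((Pi.single i (-R) : ι → ℂ) j)
            = v l i * inner ℝ (T i) (-R) := by
          rw [Finset.sum_eq_single i]
          · simp
          · intro j _ hj; simp [hj]
          · simp
        have e2 : ∑ j, v l j * ‖(Pi.single i (-R) : ι → ℂ) j‖ ^ 2 = v l i * ‖R‖ ^ 2 := by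
          rw [Finset.sum_eq_single i]
          · simp
          · intro j _ hj; simp [hj]
          · simp
        rw [e1, e2]
        ring)
  have e3 : ∑ j, inner ℝ (T j - S j) ((Pi.single i (-R) : ι → ℂ) j)
      = inner ℝ (T i - S i) (-R) := by
    rw [Finset.sum_eq_single i]
    · simp
    · intro j _ hj; simp [hj]
    · simp
  rw [e3, ← Finset.sum_mul, ← mul_assoc, ← real_inner_smul_left, ← inner_add_left, ← hR,
    inner_neg_right, real_inner_self_eq_norm_sq] at key
  have hR0 : R = 0 := by
    rw [← norm_eq_zero, ← sq_eq_zero_iff]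
    exact le_antisymm (by linarith) (sq_nonneg _)
  rw [hR0] at hR
  rw [add_smul, one_smul]
  linear_combination hR

/-- If a block of the minimizer vanishes, while all other groups meeting the block are nonzero, then
the data on that block are small. -/
lemma lassoObj_block_le {Λ : Finset ℕ} {v : ℕ → ι → ℝ} (hv : ∀ l i, 0 ≤ v l i) {μ : ℝ}
    (hμ : 0 ≤ μ) {S T : ι → ℂ} (hT : ∀ N, lassoObj Λ v μ S T ≤ lassoObj Λ v μ S N)
    (I : Finset ι) (hI : ∀ i ∈ I, T i = 0) {l₀ : ℕ} (hl₀ : l₀ ∈ Λ) {w : ℝ} (hw : 0 ≤ w)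
    (hvw : ∀ i ∈ I, v l₀ i = w ^ 2)
    (hother : ∀ l ∈ Λ, l ≠ l₀ → (∀ i ∈ I, v l i = 0) ∨ 0 < wnorm (v l) T) :
    Real.sqrt (∑ i ∈ I, ‖S i‖ ^ 2) ≤ μ * w := by
  classical
  -- Moving from `T` towards the data on `I` has rate `-s² + μ w s`: only the group `l₀` contributes
  -- at first order, since `T` vanishes on `I`.
  set D : ι → ℂ := fun i => if i ∈ I then S i else 0 with hD
  set s := Real.sqrt (∑ i ∈ I, ‖S i‖ ^ 2) with hs
  have hs0 : 0 ≤ s := Real.sqrt_nonneg _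
  have hs2 : s ^ 2 = ∑ i ∈ I, ‖S i‖ ^ 2 :=
    Real.sq_sqrt (Finset.sum_nonneg fun i _ => sq_nonneg _)
  have hwD : wnorm (v l₀) D = w * s := by
    rw [hs, wnorm, ← Real.sqrt_sq hw, ← Real.sqrt_mul (sq_nonneg _),
      Finset.mul_sum, ← Finset.sum_subset (Finset.subset_univ I)]
    · congr 1
      refine Finset.sum_congr rfl fun i hi => ?_
      rw [hvw i hi]; simp [hD, hi]
    · intro i _ hi; simp [hD, hi]
  have hTD : ∀ i, inner ℝ (T i) (D i) = 0 := by
    intro i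
    by_cases hi : i ∈ I
    · simp [hI i hi]
    · simp [hD, hi]
  have key := lassoObj_first_order hμ hT D (fun l => if l = l₀ then w * s else 0)
    (fun l => if l = l₀ then 0 else (∑ i, v l i * ‖D i‖ ^ 2) / (2 * wnorm (v l) T)) (by
      intro l hl t ht
      by_cases hll : l = l₀
      · subst hll
        simp only [if_true]
        refine (wnorm_add_le (hv l) _ _).trans (le_of_eq ?_)
        rw [wnorm_smul _ _ ht.le, hwD]
        ring
      · rw [if_neg hll, if_neg hll]
        rcases hother l hl hll with h0 | hpos
        · have e1 : wnorm (v l) (T + t • D) = wnorm (v l) T := by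
            unfold wnorm
            congr 1
            refine Finset.sum_congr rfl fun j _ => ?_
            by_cases hj : j ∈ I
            · simp [h0 j hj]
            · simp [hD, hj]
          rw [e1]
          have : 0 ≤ (∑ i, v l i * ‖D i‖ ^ 2) / (2 * wnorm (v l) T) :=
            div_nonneg (Finset.sum_nonneg fun i _ => mul_nonneg (hv l i) (sq_nonneg _))
              (mul_nonneg zero_le_two (wnorm_nonneg _ _))
          have := mul_nonneg (sq_nonneg t) this
          linarith
        · refine (wnorm_add_smul_le (hv l) hpos _ t).trans (le_of_eq ?_)
          simp [hTD])
  have e2 : ∑ i, inner ℝ (T i - S i) (D i) = - s ^ 2 := by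
    rw [hs2, ← Finset.sum_neg_distrib, ← Finset.sum_subset (Finset.subset_univ I)]
    · refine Finset.sum_congr rfl fun i hi => ?_
      rw [hI i hi, ← real_inner_self_eq_norm_sq]
      simp [hD, hi]
    · intro i _ hi; simp [hD, hi]
  rw [e2, Finset.sum_ite_eq' Λ l₀, if_pos hl₀] at key
  rcases hs0.eq_or_lt with h0 | h0
  · rw [← h0]; positivity
  · by_contra hcon
    push Not at hcon
    nlinarith

/-- Comparison of the minimizer with its restriction to the complement of `I`. -/
lemma lassoObj_restrict {Λ : Finset ℕ} {v : ℕ → ι → ℝ} {μ : ℝ}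
    {S T : ι → ℂ} (hT : ∀ N, lassoObj Λ v μ S T ≤ lassoObj Λ v μ S N)
    (I : Finset ι) [DecidablePred (· ∈ I)] :
    (1 / 2) * ∑ i ∈ I, ‖T i‖ ^ 2 + μ * ∑ l ∈ Λ, (wnorm (v l) T
      - wnorm (v l) fun i => if i ∈ I then 0 else T i) ≤ ∑ i ∈ I, ‖T i‖ * ‖S i‖ := by
  have h1 := hT (fun i => if i ∈ I then 0 else T i)
  have h2 : ∑ i, ‖T i - S i‖ ^ 2 - ∑ i, ‖(if i ∈ I then 0 else T i) - S i‖ ^ 2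
      = ∑ i ∈ I, (‖T i‖ ^ 2 - 2 * inner ℝ (T i) (S i)) := by
    rw [← Finset.sum_sub_distrib, ← Finset.sum_subset (Finset.subset_univ I)]
    · refine Finset.sum_congr rfl fun i hi => ?_
      rw [if_pos hi, norm_sub_sq_real, zero_sub, norm_neg]
      ring
    · intro i _ hi; simp [hi]
  have h3 : ∑ i ∈ I, inner ℝ (T i) (S i) ≤ ∑ i ∈ I, ‖T i‖ * ‖S i‖ :=
    Finset.sum_le_sum fun i _ => real_inner_le_norm _ _
  rw [Finset.sum_sub_distrib, ← Finset.mul_sum] at h2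
  unfold lassoObj at h1
  rw [Finset.sum_sub_distrib, mul_sub]
  linarith

end GroupLasso

/-! ### Entrywise control of the estimate at `τ = 0`. -/

section Estimate

variable {p : ℕ}

/-- The number `m` of the subdiagonal pair `s_m` that contains a position. -/
def level (jk : Fin p × Fin p) : ℕ := p - ((jk.1 : ℤ) - (jk.2 : ℤ)).natAbs

lemma natAbs_sub_lt (jk : Fin p × Fin p) : ((jk.1 : ℤ) - (jk.2 : ℤ)).natAbs < p := by
  have := jk.1.isLt
  have := jk.2.isLt
  omega

lemma one_le_level (jk : Fin p × Fin p) : 1 ≤ level jk := by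
  have := natAbs_sub_lt jk
  unfold level
  omega

lemma level_le (jk : Fin p × Fin p) : level jk ≤ p := Nat.sub_le _ _

lemma mem_sIdx {m : ℕ} {jk : Fin p × Fin p} : jk ∈ sIdx p m ↔ level jk = m := by
  have := natAbs_sub_lt jk
  unfold level
  simp only [sIdx, Finset.mem_filter, Finset.mem_univ, true_and]
  omega

lemma mem_gIdx {l : ℕ} {jk : Fin p × Fin p} : jk ∈ gIdx p l ↔ level jk ≤ l := by
  have := one_le_level jk
  simp only [gIdx, Finset.mem_biUnion, Finset.mem_Icc, mem_sIdx]
  constructor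
  · rintro ⟨m, ⟨_, h⟩, h'⟩
    omega
  · intro h
    exact ⟨_, ⟨this, h⟩, rfl⟩

lemma card_sIdx_le {m : ℕ} (_hm : m < p) : (sIdx p m).card ≤ 2 * m := by
  rw [← Finset.card_range (2 * m)]
  refine Finset.card_le_card_of_injOn
    -- Entries above the diagonal have row index below `m`, those below it have column index below
    -- `m`; adding `m` separates the two halves.
    (fun jk => if (jk.1 : ℕ) < jk.2 then (jk.1 : ℕ) else (jk.2 : ℕ) + m) ?_ ?_
  · rintro ⟨⟨j, hj⟩, ⟨k, hk⟩⟩ h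
    simp only [Finset.mem_coe, mem_sIdx, level] at h
    simp only [Finset.coe_range, Set.mem_Iio]
    split_ifs <;> omega
  · rintro ⟨⟨j, hj⟩, ⟨k, hk⟩⟩ h ⟨⟨j', hj'⟩, ⟨k', hk'⟩⟩ h' e
    simp only [Finset.mem_coe, mem_sIdx, level] at h h'
    simp only at e
    simp only [Prod.mk.injEq, Fin.mk.injEq]
    split_ifs at e <;> omega

/-- The entries of a matrix as a function of the position. -/
def entries (M : Matrix (Fin p) (Fin p) ℂ) : Fin p × Fin p → ℂ := fun jk => M jk.1 jk.2

/-- The squared weight of a position in the `l`-th group of the penalty. -/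
noncomputable def groupWeight (l : ℕ) (jk : Fin p × Fin p) : ℝ :=
  if level jk ≤ l then weight l (level jk) ^ 2 else 0

lemma groupWeight_nonneg (l : ℕ) (jk : Fin p × Fin p) : 0 ≤ groupWeight l jk := by
  unfold groupWeight
  split_ifs
  · positivity
  · exact le_rfl

lemma entryNorm_nonneg (I : Finset (Fin p × Fin p)) (M : Matrix (Fin p) (Fin p) ℂ) :
    0 ≤ entryNorm I M := Real.sqrt_nonneg _

lemma entryNorm_sq (I : Finset (Fin p × Fin p)) (M : Matrix (Fin p) (Fin p) ℂ) :
    entryNorm I M ^ 2 = ∑ jk ∈ I, ‖M jk.1 jk.2‖ ^ 2 :=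
  Real.sq_sqrt (Finset.sum_nonneg fun _ _ => sq_nonneg _)

lemma sIdx_eq_filter (m : ℕ) : sIdx p m = Finset.univ.filter fun jk => level jk = m := by
  ext jk
  simp [mem_sIdx]

lemma penalty_eq (M : Matrix (Fin p) (Fin p) ℂ) :
    penalty M = ∑ l ∈ Finset.Icc 1 (p - 1), wnorm (groupWeight l) (entries M) := by
  unfold penalty
  refine Finset.sum_congr rfl fun l _ => ?_
  unfold wnorm
  congr 1
  have h1 : ∀ m, weight l m ^ 2 * entryNorm (sIdx p m) M ^ 2
      = ∑ jk, if level jk = m then weight l m ^ 2 * ‖entries M jk‖ ^ 2 else 0 := by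
    intro m
    rw [entryNorm_sq, sIdx_eq_filter, Finset.sum_filter, Finset.mul_sum]
    refine Finset.sum_congr rfl fun jk _ => ?_
    simp [entries]
  simp_rw [h1]
  rw [Finset.sum_comm]
  refine Finset.sum_congr rfl fun jk _ => ?_
  rw [Finset.sum_ite_eq]
  have := one_le_level jk
  simp [groupWeight, this]

lemma objective_eq (S : Matrix (Fin p) (Fin p) ℂ) (τ μ : ℝ) (M : Matrix (Fin p) (Fin p) ℂ) :
    objective S τ μ M = lassoObj (Finset.Icc 1 (p - 1)) groupWeight μ
      (entries (S + (τ : ℂ) • (1 : Matrix (Fin p) (Fin p) ℂ))) (entries M) := by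
  unfold objective lassoObj
  rw [penalty_eq, entryNorm_sq]
  rfl

lemma isBandedEstimate_zero_iff {S : Matrix (Fin p) (Fin p) ℂ} {μ : ℝ}
    {M : Matrix (Fin p) (Fin p) ℂ} :
    IsBandedEstimate S 0 μ M ↔ ∀ N, lassoObj (Finset.Icc 1 (p - 1)) groupWeight μ (entries S)
      (entries M) ≤ lassoObj (Finset.Icc 1 (p - 1)) groupWeight μ (entries S) N := by
  unfold IsBandedEstimate
  simp only [objective_eq, Complex.ofReal_zero, zero_smul, add_zero]
  exact ⟨fun h N => h (Matrix.of fun j k => N (j, k)), fun h N => h _⟩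

lemma entryNorm_le_of_le {I : Finset (Fin p × Fin p)} {M N : Matrix (Fin p) (Fin p) ℂ} {a : ℝ}
    (ha : 0 ≤ a) (h : ∀ jk ∈ I, ‖M jk.1 jk.2‖ ≤ a * ‖N jk.1 jk.2‖) :
    entryNorm I M ≤ a * entryNorm I N := by
  refine Real.sqrt_le_iff.2 ⟨mul_nonneg ha (entryNorm_nonneg _ _), ?_⟩
  rw [mul_pow, entryNorm_sq, Finset.mul_sum]
  refine Finset.sum_le_sum fun jk hjk => ?_
  rw [← mul_pow]
  have := h jk hjk
  gcongr

lemma entryNorm_eq_wnorm (I : Finset (Fin p × Fin p)) (M : Matrix (Fin p) (Fin p) ℂ) :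
    entryNorm I M = wnorm (fun jk => if jk ∈ I then 1 else 0) (entries M) := by
  unfold entryNorm wnorm
  simp [entries]

lemma entryNorm_add_le (I : Finset (Fin p × Fin p)) (M N : Matrix (Fin p) (Fin p) ℂ) :
    entryNorm I (M + N) ≤ entryNorm I M + entryNorm I N := by
  simp only [entryNorm_eq_wnorm]
  exact wnorm_add_le (fun jk => by split_ifs <;> norm_num) _ _

lemma entryNorm_neg (I : Finset (Fin p × Fin p)) (M : Matrix (Fin p) (Fin p) ℂ) :
    entryNorm I (-M) = entryNorm I M := by
  simp [entryNorm]

lemma entryNorm_sIdx_le {m : ℕ} (hm : m < p) {M : Matrix (Fin p) (Fin p) ℂ} {δ : ℝ} (hδ : 0 ≤ δ)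
    (h : ∀ j k, ‖M j k‖ ≤ δ) : entryNorm (sIdx p m) M ≤ Real.sqrt (2 * m) * δ := by
  refine Real.sqrt_le_iff.2 ⟨by positivity, ?_⟩
  rw [mul_pow, Real.sq_sqrt (by positivity)]
  calc ∑ jk ∈ sIdx p m, ‖M jk.1 jk.2‖ ^ 2 ≤ ∑ _jk ∈ sIdx p m, δ ^ 2 :=
        Finset.sum_le_sum fun jk _ => by have := h jk.1 jk.2; gcongr
    _ = (sIdx p m).card * δ ^ 2 := by simp
    _ ≤ 2 * m * δ ^ 2 := by
        have : ((sIdx p m).card : ℝ) ≤ 2 * m := by exact_mod_cast card_sIdx_le hm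
        gcongr

lemma groupWeight_self {m : ℕ} {jk : Fin p × Fin p} (h : level jk = m) :
    groupWeight m jk = Real.sqrt (2 * m) ^ 2 := by
  simp [groupWeight, weight, h]

/-- The weight of the innermost pair of its own group is `w_{m,m} = √(2m)`. -/
lemma sqrt_mul_entryNorm_le_wnorm (m : ℕ) (M : Matrix (Fin p) (Fin p) ℂ) :
    Real.sqrt (2 * m) * entryNorm (sIdx p m) M ≤ wnorm (groupWeight m) (entries M) := by
  refine Real.le_sqrt_of_sq_le ?_
  rw [mul_pow, entryNorm_sq, Finset.mul_sum]
  refine (Finset.sum_le_sum fun jk hjk => ?_).trans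
    (Finset.sum_le_sum_of_subset_of_nonneg (Finset.subset_univ (sIdx p m)) fun jk _ _ =>
      mul_nonneg (groupWeight_nonneg m jk) (sq_nonneg _))
  rw [groupWeight_self (mem_sIdx.1 hjk)]
  rfl

/-- Cauchy–Schwarz with at most `2m` positions. The factor `√(2m)` is exactly the weight `w_{m,m}`,
so the penalty dominates an ℓ¹ norm and can absorb noise bounded entrywise. -/
lemma sum_norm_sIdx_le {m : ℕ} (hm : m < p) (M : Matrix (Fin p) (Fin p) ℂ) :
    ∑ jk ∈ sIdx p m, ‖M jk.1 jk.2‖ ≤ Real.sqrt (2 * m) * entryNorm (sIdx p m) M := by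
  have h := Real.sum_mul_le_sqrt_mul_sqrt (sIdx p m) (fun _ => 1) (fun jk => ‖M jk.1 jk.2‖)
  simp only [one_mul, one_pow, Finset.sum_const, nsmul_eq_mul, mul_one] at h
  refine h.trans ?_
  have : ((sIdx p m).card : ℝ) ≤ 2 * m := by exact_mod_cast card_sIdx_le hm
  unfold entryNorm
  gcongr

lemma sum_gIdx (l : ℕ) (f : Fin p × Fin p → ℝ) :
    ∑ jk ∈ gIdx p l, f jk = ∑ m ∈ Finset.Icc 1 l, ∑ jk ∈ sIdx p m, f jk := by
  refine Finset.sum_biUnion fun m _ m' _ hmm => ?_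
  refine Finset.disjoint_left.2 fun jk h h' => hmm ?_
  rw [← mem_sIdx.1 h, ← mem_sIdx.1 h']

/-- Outside of the band the estimate is controlled by the covariance. -/
lemma entryNorm_outside_le {S Cov T : Matrix (Fin p) (Fin p) ℂ} {δ μ : ℝ} (hδ : 0 ≤ δ)
    (hδμ : δ ≤ μ) (hS : ∀ j k, ‖S j k - Cov j k‖ ≤ δ) (hT : IsBandedEstimate S 0 μ T)
    {B : ℕ} (hB : B < p) :
    entryNorm (gIdx p B) T ≤ 2 * entryNorm (gIdx p B) Cov := by
  rw [isBandedEstimate_zero_iff] at hT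
  have h1 := lassoObj_restrict hT (gIdx p B)
  set N : Fin p × Fin p → ℂ := fun i => if i ∈ gIdx p B then 0 else entries T i with hN
  -- For `l ≤ B` the whole group lies in `g_B`, so its norm is saved entirely; larger groups can
  -- only decrease.
  have h2 : ∑ l ∈ Finset.Icc 1 B, Real.sqrt (2 * l) * entryNorm (sIdx p l) T ≤
      ∑ l ∈ Finset.Icc 1 (p - 1), (wnorm (groupWeight l) (entries T) - wnorm (groupWeight l) N) := by
    refine (Finset.sum_le_sum fun l hl => ?_).trans
      (Finset.sum_le_sum_of_subset_of_nonneg (Finset.Icc_subset_Icc_right (by omega))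
        fun l _ _ => sub_nonneg.2 (wnorm_mono (groupWeight_nonneg l) fun jk => ?_))
    · have : wnorm (groupWeight l) N = 0 := by
        unfold wnorm
        rw [Finset.sum_eq_zero, Real.sqrt_zero]
        intro jk _
        by_cases hjk : level jk ≤ B
        · simp [hN, mem_gIdx, hjk]
        · have : ¬ level jk ≤ l := by
            have := (Finset.mem_Icc.1 hl).2
            omega
          simp [groupWeight, this]
      rw [this, sub_zero]
      exact sqrt_mul_entryNorm_le_wnorm l T
    · by_cases hjk : jk ∈ gIdx p B <;> simp [hN, hjk]
  have h3 : ∑ jk ∈ gIdx p B, ‖entries T jk‖ ≤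
      ∑ l ∈ Finset.Icc 1 B, Real.sqrt (2 * l) * entryNorm (sIdx p l) T := by
    rw [sum_gIdx]
    refine Finset.sum_le_sum fun l hl => sum_norm_sIdx_le ?_ T
    have := (Finset.mem_Icc.1 hl).2
    omega
  have h4 : ∑ jk ∈ gIdx p B, ‖entries T jk‖ * ‖entries S jk‖ ≤
      entryNorm (gIdx p B) T * entryNorm (gIdx p B) Cov + δ * ∑ jk ∈ gIdx p B, ‖entries T jk‖ := by
    refine le_trans ?_ (add_le_add_left (Real.sum_mul_le_sqrt_mul_sqrt (gIdx p B)
      (fun jk => ‖T jk.1 jk.2‖) (fun jk => ‖Cov jk.1 jk.2‖)) _)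
    rw [Finset.mul_sum, ← Finset.sum_add_distrib]
    refine Finset.sum_le_sum fun jk _ => ?_
    have e1 : ‖S jk.1 jk.2‖ ≤ ‖Cov jk.1 jk.2‖ + δ := by
      have := norm_sub_norm_le (S jk.1 jk.2) (Cov jk.1 jk.2)
      have := hS jk.1 jk.2
      linarith
    have := mul_le_mul_of_nonneg_left e1 (norm_nonneg (T jk.1 jk.2))
    simp only [entries]
    linarith
  have h5 : ∑ jk ∈ gIdx p B, ‖entries T jk‖ ^ 2 = entryNorm (gIdx p B) T ^ 2 :=
    (entryNorm_sq _ _).symm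
  rw [h5] at h1
  have h6 : 0 ≤ ∑ jk ∈ gIdx p B, ‖entries T jk‖ := Finset.sum_nonneg fun _ _ => norm_nonneg _
  -- Since `δ ≤ μ`, the saved penalty cancels the noise term `δ ∑ ‖T‖` of `h4`.
  have h7 := mul_le_mul_of_nonneg_left (h3.trans h2) (hδ.trans hδμ)
  have h8 := mul_le_mul_of_nonneg_right hδμ h6
  have h9 : entryNorm (gIdx p B) T ^ 2 ≤
      entryNorm (gIdx p B) T * (2 * entryNorm (gIdx p B) Cov) := by linarith
  rcases (entryNorm_nonneg (gIdx p B) T).eq_or_lt with h0 | h0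
  · rw [← h0]
    exact mul_nonneg zero_le_two (entryNorm_nonneg _ _)
  · rw [sq] at h9
    exact le_of_mul_le_mul_left h9 h0

lemma entryNorm_sIdx_ge {S Cov : Matrix (Fin p) (Fin p) ℂ} {δ c' : ℝ} (hδ : 0 ≤ δ)
    (hS : ∀ j k, ‖S j k - Cov j k‖ ≤ δ) {m : ℕ} (hm1 : 0 < m) (hm : m < p)
    (hc : c' ≤ entryNorm (sIdx p m) Cov / Real.sqrt (2 * m)) :
    (c' - δ) * Real.sqrt (2 * m) ≤ entryNorm (sIdx p m) S := by
  have hpos : 0 < Real.sqrt (2 * m) := Real.sqrt_pos.2 (by positivity)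
  rw [le_div_iff₀ hpos] at hc
  have h1 := entryNorm_add_le (sIdx p m) S (-(S - Cov))
  rw [entryNorm_neg] at h1
  have h2 : S + -(S - Cov) = Cov := by abel
  rw [h2] at h1
  have h3 := entryNorm_sIdx_le hm (M := S - Cov) hδ hS
  linarith

/-- Inside of the band the estimate does not vanish. -/
lemma entryNorm_sIdx_pos {S Cov T : Matrix (Fin p) (Fin p) ℂ} {δ μ c' : ℝ} (hδ : 0 ≤ δ)
    (hμ : 0 ≤ μ) (hc' : δ + μ < c') (hS : ∀ j k, ‖S j k - Cov j k‖ ≤ δ)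
    (hT : IsBandedEstimate S 0 μ T) {B : ℕ}
    (hsig : ∀ l, B < l → l < p → c' ≤ entryNorm (sIdx p l) Cov / Real.sqrt (2 * (l : ℝ)))
    {m : ℕ} (hBm : B < m) (hm : m < p) : 0 < entryNorm (sIdx p m) T := by
  rw [isBandedEstimate_zero_iff] at hT
  -- Induction outwards from the diagonal: `s_m` meets only the groups `l ≥ m`, and those with `l >
  -- m` are already nonzero. Were `s_m` zero in `T`, the data there would have norm at most `μ
  -- √(2m)`, below the signal.
  induction h : p - m using Nat.strong_induction_on generalizing m with
  | _ n ih =>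
    refine lt_of_le_of_ne (entryNorm_nonneg _ _) fun h0 => ?_
    have hz : ∀ jk ∈ sIdx p m, entries T jk = 0 := by
      have h1 : ∑ jk ∈ sIdx p m, ‖T jk.1 jk.2‖ ^ 2 = 0 := by
        rw [← entryNorm_sq, ← h0]; simp
      rw [Finset.sum_eq_zero_iff_of_nonneg fun _ _ => sq_nonneg _] at h1
      intro jk hjk
      have := h1 jk hjk
      rwa [sq_eq_zero_iff, norm_eq_zero] at this
    have key := lassoObj_block_le groupWeight_nonneg hμ hT (sIdx p m) hz
      (l₀ := m) (Finset.mem_Icc.2 ⟨by omega, by omega⟩) (Real.sqrt_nonneg (2 * m))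
      (fun jk hjk => groupWeight_self (mem_sIdx.1 hjk)) (by
        intro l hl hlm
        rw [Finset.mem_Icc] at hl
        rcases lt_or_gt_of_ne hlm with hlt | hgt
        · left
          intro jk hjk
          rw [mem_sIdx] at hjk
          have : ¬ level jk ≤ l := by omega
          simp [groupWeight, this]
        · right
          refine lt_of_lt_of_le ?_ (sqrt_mul_entryNorm_le_wnorm l T)
          have hl0 : (0 : ℝ) < l := by exact_mod_cast (by omega : 0 < l)
          exact mul_pos (Real.sqrt_pos.2 (by positivity))
            (ih (p - l) (by omega) (by omega) (by omega) rfl))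
    have h2 := entryNorm_sIdx_ge hδ hS (by omega) hm (hsig m hBm hm)
    have hm0 : (0 : ℝ) < m := by exact_mod_cast (by omega : 0 < m)
    have hpos : 0 < Real.sqrt (2 * m) := Real.sqrt_pos.2 (by positivity)
    have h3 : (c' - δ) * Real.sqrt (2 * m) ≤ μ * Real.sqrt (2 * m) := h2.trans key
    have := le_of_mul_le_mul_right h3 hpos
    linarith

lemma sum_inv_sq_le_two (m n : ℕ) (h : m ≤ n) :
    ∑ l ∈ Finset.Ico m n, 1 / ((l : ℝ) - m + 1) ^ 2 ≤ 2 - 1 / ((n : ℝ) - m + 1 / 2) := by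
  induction n, h using Nat.le_induction with
  | base => norm_num
  | succ n hn ih =>
    rw [Finset.sum_Ico_succ_top hn]
    have hd : (0 : ℝ) ≤ n - m := sub_nonneg.2 (by exact_mod_cast hn)
    have e : (((n + 1 : ℕ) : ℝ) - m + 1 / 2) = (n - m) + 3 / 2 := by push_cast; ring
    rw [e]
    generalize (n : ℝ) - m = d at *
    -- The telescoping difference equals `1 / ((d + 1)² - 1/4)`; the shift by one half makes the
    -- bound vanish for the empty sum.
    have h1 : 1 / (d + 1) ^ 2 ≤ 1 / (d + 1 / 2) - 1 / (d + 3 / 2) := by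
      rw [div_sub_div _ _ (by positivity) (by positivity), div_le_div_iff₀ (by positivity)
        (by positivity)]
      nlinarith
    linarith

/-- On the diagonal the estimate agrees with the data. -/
lemma estimate_diag {S T : Matrix (Fin p) (Fin p) ℂ} {μ : ℝ} (hμ : 0 ≤ μ)
    (hT : IsBandedEstimate S 0 μ T) (j : Fin p) : T j j = S j j := by
  rw [isBandedEstimate_zero_iff] at hT
  have hz : ∀ l ∈ Finset.Icc 1 (p - 1), groupWeight l (j, j) = 0 := by
    intro l hl
    rw [Finset.mem_Icc] at hl
    have : ¬ level (j, j) ≤ l := by simp [level]; omega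
    simp [groupWeight, this]
  have h := lassoObj_stationary groupWeight_nonneg hμ hT (j, j) fun l hl h => absurd (hz l hl) h
  rw [Finset.sum_eq_zero fun l hl => by rw [hz l hl, zero_div]] at h
  simpa [entries] using h.symm

/-- Stationarity gives `f = ∑ₗ w²_{l,m} / ‖T‖ₗ`. The `l`-th group norm is at least `2lα` and
`w²_{l,m} = 2l / (l-m+1)²`, so `2l` cancels and a convergent series remains, with no dependence on
`p`. -/
lemma estimate_shrink {S T : Matrix (Fin p) (Fin p) ℂ} {μ α : ℝ} (hμ : 0 ≤ μ)
    (hT : IsBandedEstimate S 0 μ T) {B : ℕ} (hα : 0 < α)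
    (hαT : ∀ l, B < l → l < p → α ≤ entryNorm (sIdx p l) T / Real.sqrt (2 * (l : ℝ)))
    {jk : Fin p × Fin p} (hjk : B < level jk) :
    ∃ f : ℝ, 0 ≤ f ∧ f ≤ 2 / α ∧ S jk.1 jk.2 = (1 + μ * f : ℝ) • T jk.1 jk.2 := by
  rw [isBandedEstimate_zero_iff] at hT
  have hw : ∀ l, B < l → l < p → 2 * l * α ≤ wnorm (groupWeight l) (entries T) := by
    intro l h1 h2
    refine le_trans ?_ (sqrt_mul_entryNorm_le_wnorm l T)
    have hl0 : (0 : ℝ) < l := by exact_mod_cast (by omega : 0 < l)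
    have hpos : 0 < Real.sqrt (2 * l) := Real.sqrt_pos.2 (by positivity)
    have h3 := hαT l h1 h2
    rw [le_div_iff₀ hpos] at h3
    calc 2 * l * α = Real.sqrt (2 * l) * (α * Real.sqrt (2 * l)) := by
          have := Real.mul_self_sqrt (show (0 : ℝ) ≤ 2 * l by positivity)
          linear_combination (-α) * this
      _ ≤ _ := by gcongr
  have hterm : ∀ l ∈ Finset.Icc 1 (p - 1), groupWeight l jk ≠ 0 → level jk ≤ l ∧ l < p := by
    intro l hl h
    rw [Finset.mem_Icc] at hl
    refine ⟨?_, by omega⟩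
    by_contra hlt
    exact h (by simp [groupWeight, hlt])
  refine ⟨∑ l ∈ Finset.Icc 1 (p - 1), groupWeight l jk / wnorm (groupWeight l) (entries T),
    Finset.sum_nonneg fun l _ => div_nonneg (groupWeight_nonneg _ _) (wnorm_nonneg _ _), ?_,
    lassoObj_stationary groupWeight_nonneg hμ hT jk fun l hl h => ?_⟩
  · have hsub : Finset.Ico (level jk) p ⊆ Finset.Icc 1 (p - 1) := by
      intro l hl
      have := one_le_level jk
      rw [Finset.mem_Ico] at hl
      rw [Finset.mem_Icc]
      omega
    rw [← Finset.sum_subset hsub]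
    · calc ∑ l ∈ Finset.Ico (level jk) p, groupWeight l jk / wnorm (groupWeight l) (entries T)
          ≤ ∑ l ∈ Finset.Ico (level jk) p, (1 / α) * (1 / ((l : ℝ) - level jk + 1) ^ 2) := by
            refine Finset.sum_le_sum fun l hl => ?_
            rw [Finset.mem_Ico] at hl
            have hl0 : (0 : ℝ) < l := by exact_mod_cast (by omega : 0 < l)
            have hd : (0 : ℝ) ≤ l - level jk := sub_nonneg.2 (by exact_mod_cast hl.1)
            have h1 := hw l (by omega) hl.2
            have h2 : groupWeight l jk = 2 * l / ((l : ℝ) - level jk + 1) ^ 2 := by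
              rw [groupWeight, if_pos hl.1, weight, div_pow, Real.sq_sqrt (by positivity)]
            rw [h2]
            calc 2 * l / ((l : ℝ) - level jk + 1) ^ 2 / wnorm (groupWeight l) (entries T)
                ≤ 2 * l / ((l : ℝ) - level jk + 1) ^ 2 / (2 * l * α) := by gcongr
              _ = _ := by field_simp
        _ = (1 / α) * ∑ l ∈ Finset.Ico (level jk) p, 1 / ((l : ℝ) - level jk + 1) ^ 2 := by
            rw [Finset.mul_sum]
        _ ≤ (1 / α) * 2 := by
            have h1 := sum_inv_sq_le_two _ _ (level_le jk)
            have hd : (0 : ℝ) ≤ p - level jk := sub_nonneg.2 (by exact_mod_cast level_le jk)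
            have h2 : (0 : ℝ) ≤ 1 / ((p : ℝ) - level jk + 1 / 2) := by positivity
            gcongr
            linarith
        _ = 2 / α := by ring
    · intro l hl hl'
      by_contra h
      have := hterm l hl fun h0 => h (by rw [h0, zero_div])
      exact hl' (Finset.mem_Ico.2 this)
  · obtain ⟨h1, h2⟩ := hterm l hl h
    refine lt_of_lt_of_le ?_ (hw l (by omega) h2)
    have hl0 : (0 : ℝ) < l := by
      have := one_le_level jk
      exact_mod_cast (by omega : 0 < l)
    positivity

/-- Inside of the band the shrinkage is of the order of the regularization parameter. -/
lemma estimate_inBand {S Cov T : Matrix (Fin p) (Fin p) ℂ} {δ μ c' : ℝ} (hδ : 0 ≤ δ)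
    (hμ : 0 ≤ μ) (hc0 : 0 < c') (hc' : 2 * (δ + 2 * μ) ≤ c') (hS : ∀ j k, ‖S j k - Cov j k‖ ≤ δ)
    (hT : IsBandedEstimate S 0 μ T) {B : ℕ}
    (hsig : ∀ l, B < l → l < p → c' ≤ entryNorm (sIdx p l) Cov / Real.sqrt (2 * (l : ℝ)))
    {jk : Fin p × Fin p} (hjk : B < level jk) :
    ‖T jk.1 jk.2 - S jk.1 jk.2‖ ≤ μ * (4 / c') * ‖S jk.1 jk.2‖ := by
  set a : ℕ → ℝ := fun l => entryNorm (sIdx p l) T / Real.sqrt (2 * (l : ℝ)) with ha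
  have hpos : ∀ l, B < l → l < p → 0 < a l := fun l h1 h2 =>
    div_pos (entryNorm_sIdx_pos hδ hμ (by linarith) hS hT hsig h1 h2)
      (Real.sqrt_pos.2 (by have : 0 < l := by omega
                           positivity))
  -- Self-improvement at the level `m` minimizing `a`: shrinkage with `α = a m` yields `c' - δ ≤ a m
  -- + 2μ`, turning mere positivity into the uniform bound `c' / 2`.
  have hlow : ∀ l, B < l → l < p → c' / 2 ≤ a l := by
    intro l h1 h2
    obtain ⟨m, hm, hmin⟩ := Finset.exists_min_image (Finset.Ioo B p) a
      ⟨l, Finset.mem_Ioo.2 ⟨h1, h2⟩⟩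
    refine le_trans ?_ (hmin l (Finset.mem_Ioo.2 ⟨h1, h2⟩))
    rw [Finset.mem_Ioo] at hm
    have hα := hpos m hm.1 hm.2
    have hm0 : (0 : ℝ) < m := by exact_mod_cast (by omega : 0 < m)
    have hsq : 0 < Real.sqrt (2 * m) := Real.sqrt_pos.2 (by positivity)
    have h3 : entryNorm (sIdx p m) S ≤ (1 + μ * (2 / a m)) * entryNorm (sIdx p m) T := by
      refine entryNorm_le_of_le (by positivity) fun jk' hjk' => ?_
      obtain ⟨f, hf0, hf, e⟩ := estimate_shrink hμ hT hα
        (fun l h1 h2 => hmin l (Finset.mem_Ioo.2 ⟨h1, h2⟩)) (jk := jk')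
        (by rw [mem_sIdx.1 hjk']; exact hm.1)
      rw [e, norm_smul, Real.norm_eq_abs, abs_of_nonneg (by positivity)]
      gcongr
    have h4 := (entryNorm_sIdx_ge hδ hS (by omega) hm.2 (hsig m hm.1 hm.2)).trans h3
    have h5 : entryNorm (sIdx p m) T = a m * Real.sqrt (2 * m) := by
      rw [ha]; field_simp
    have h6 : (1 + μ * (2 / a m)) * entryNorm (sIdx p m) T = (a m + 2 * μ) * Real.sqrt (2 * m) := by
      rw [h5]; field_simp
    rw [h6] at h4
    have := le_of_mul_le_mul_right h4 hsq
    linarith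
  obtain ⟨f, hf0, hf, e⟩ := estimate_shrink hμ hT (half_pos hc0) hlow hjk
  have e1 : T jk.1 jk.2 - S jk.1 jk.2 = (-(μ * f) : ℝ) • T jk.1 jk.2 := by
    rw [e, add_smul, one_smul, neg_smul]; ring
  have e2 : ‖T jk.1 jk.2‖ ≤ ‖S jk.1 jk.2‖ := by
    rw [e, norm_smul, Real.norm_eq_abs, abs_of_nonneg (by positivity)]
    have : 1 ≤ 1 + μ * f := by have := mul_nonneg hμ hf0; linarith
    exact le_mul_of_one_le_left (norm_nonneg _) this
  rw [e1, norm_smul, norm_neg, Real.norm_eq_abs, abs_of_nonneg (by positivity)]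
  have : f ≤ 4 / c' := hf.trans (le_of_eq (by field_simp; norm_num))
  gcongr

end Estimate

/-! ### From entrywise bounds to positive semidefiniteness. -/

section Deterministic

open Matrix
open scoped ComplexOrder

variable {p : ℕ}

/-- The quadratic form of a matrix which is small inside of the band and outside of it. -/
lemma norm_quadForm_le {E : Matrix (Fin p) (Fin p) ℂ} {B L : ℕ} (hBL : B + 1 + L = p) {b : ℝ}
    (hb : 0 ≤ b) (hE : ∀ jk : Fin p × Fin p, B < level jk → ‖E jk.1 jk.2‖ ≤ b) (u : Fin p → ℂ) :
    ‖star u ⬝ᵥ (E *ᵥ u)‖ ≤ ((2 * L + 1) * b + entryNorm (gIdx p B) E) * ∑ j, ‖u j‖ ^ 2 := by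
  classical
  have h0 : ‖star u ⬝ᵥ (E *ᵥ u)‖ ≤
      ∑ jk : Fin p × Fin p, ‖E jk.1 jk.2‖ * (‖u jk.1‖ * ‖u jk.2‖) := by
    rw [Fintype.sum_prod_type]
    refine (norm_sum_le _ _).trans (Finset.sum_le_sum fun j _ => ?_)
    rw [norm_mul, Pi.star_apply, norm_star, mulVec, dotProduct]
    refine (mul_le_mul_of_nonneg_left (norm_sum_le _ _) (norm_nonneg _)).trans (le_of_eq ?_)
    rw [Finset.mul_sum]
    refine Finset.sum_congr rfl fun k _ => ?_
    rw [norm_mul]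
    ring
  have hprod : ∑ jk : Fin p × Fin p, (‖u jk.1‖ * ‖u jk.2‖) ^ 2 = (∑ j, ‖u j‖ ^ 2) ^ 2 := by
    rw [Fintype.sum_prod_type, sq (∑ j, ‖u j‖ ^ 2), Finset.sum_mul_sum]
    exact Finset.sum_congr rfl fun j _ => Finset.sum_congr rfl fun k _ => by ring
  have hU : 0 ≤ ∑ j, ‖u j‖ ^ 2 := Finset.sum_nonneg fun _ _ => sq_nonneg _
  have h1 : ∑ jk ∈ gIdx p B, ‖E jk.1 jk.2‖ * (‖u jk.1‖ * ‖u jk.2‖) ≤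
      entryNorm (gIdx p B) E * ∑ j, ‖u j‖ ^ 2 := by
    refine (Real.sum_mul_le_sqrt_mul_sqrt _ _ _).trans ?_
    refine mul_le_mul_of_nonneg_left ?_ (entryNorm_nonneg _ _)
    rw [← Real.sqrt_sq hU, ← hprod]
    exact Real.sqrt_le_sqrt (Finset.sum_le_sum_of_subset_of_nonneg (Finset.subset_univ _)
      fun _ _ _ => sq_nonneg _)
  have hcard : ∀ j : Fin p, ((Finset.univ.filter fun k : Fin p =>
      ((j : ℤ) - (k : ℤ)).natAbs ≤ L).card : ℝ) ≤ 2 * L + 1 := by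
    intro j
    have : (Finset.univ.filter fun k : Fin p => ((j : ℤ) - (k : ℤ)).natAbs ≤ L).card
        ≤ (Finset.range (2 * L + 1)).card := by
      -- The natural subtraction never truncates, because `j ≤ k + L` on this set.
      refine Finset.card_le_card_of_injOn (fun k => (k : ℕ) + L - j) ?_ ?_
      · intro k hk
        simp only [Finset.coe_filter, Finset.mem_univ, true_and, Set.mem_ofPred_eq] at hk
        simp only [Finset.coe_range, Set.mem_Iio]
        omega
      · intro k hk k' hk' e
        simp only [Finset.coe_filter, Finset.mem_univ, true_and, Set.mem_ofPred_eq] at hk hk'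
        simp only at e
        ext
        omega
    rw [Finset.card_range] at this
    exact_mod_cast this
  have hrow : ∀ f : Fin p → ℝ, (∀ j, 0 ≤ f j) → ∑ j : Fin p, ∑ k : Fin p,
      (if ((j : ℤ) - (k : ℤ)).natAbs ≤ L then f j else 0) ≤ (2 * L + 1) * ∑ j, f j := by
    intro f hf
    rw [Finset.mul_sum]
    refine Finset.sum_le_sum fun j _ => ?_
    rw [← Finset.sum_filter, Finset.sum_const, nsmul_eq_mul]
    exact mul_le_mul_of_nonneg_right (hcard j) (hf j)
  have h2 : ∑ jk ∈ (gIdx p B)ᶜ, ‖E jk.1 jk.2‖ * (‖u jk.1‖ * ‖u jk.2‖) ≤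
      (2 * L + 1) * b * ∑ j, ‖u j‖ ^ 2 := by
    -- Schur test: half of each band term is charged to its row and half to its column, each having
    -- at most `2L + 1` band entries.
    have h3 : ∑ jk ∈ (gIdx p B)ᶜ, ‖E jk.1 jk.2‖ * (‖u jk.1‖ * ‖u jk.2‖) ≤
        ∑ jk : Fin p × Fin p, (if ((jk.1 : ℤ) - (jk.2 : ℤ)).natAbs ≤ L then
          b / 2 * ‖u jk.1‖ ^ 2 else 0) + ∑ jk : Fin p × Fin p,
          (if ((jk.2 : ℤ) - (jk.1 : ℤ)).natAbs ≤ L then b / 2 * ‖u jk.2‖ ^ 2 else 0) := by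
      rw [← Finset.sum_add_distrib]
      refine (Finset.sum_le_sum fun jk hjk => ?_).trans
        (Finset.sum_le_sum_of_subset_of_nonneg (Finset.subset_univ (gIdx p B)ᶜ)
          fun jk _ _ => ?_)
      · rw [Finset.mem_compl, mem_gIdx, not_le] at hjk
        have hl : ((jk.1 : ℤ) - (jk.2 : ℤ)).natAbs ≤ L := by
          unfold level at hjk
          omega
        have hl' : ((jk.2 : ℤ) - (jk.1 : ℤ)).natAbs ≤ L := by omega
        rw [if_pos hl, if_pos hl']
        calc ‖E jk.1 jk.2‖ * (‖u jk.1‖ * ‖u jk.2‖) ≤ b * (‖u jk.1‖ * ‖u jk.2‖) := by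
              have := hE jk hjk
              gcongr
          _ ≤ b * ((‖u jk.1‖ ^ 2 + ‖u jk.2‖ ^ 2) / 2) := by
              have := two_mul_le_add_sq ‖u jk.1‖ ‖u jk.2‖
              gcongr
              linarith
          _ = _ := by ring
      · have : ∀ a : ℝ, 0 ≤ b / 2 * a ^ 2 := fun a => by positivity
        refine add_nonneg ?_ ?_ <;> split_ifs <;> first | exact this _ | exact le_rfl
    refine h3.trans ?_
    rw [Fintype.sum_prod_type, Fintype.sum_prod_type_right]
    have := hrow (fun j => b / 2 * ‖u j‖ ^ 2) fun j => by positivity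
    refine (add_le_add this this).trans (le_of_eq ?_)
    rw [← Finset.mul_sum]
    ring
  rw [← Finset.sum_add_sum_compl (gIdx p B)] at h0
  linarith

lemma IsMinEigenvalue.posSemidef_sub {A : Matrix (Fin p) (Fin p) ℂ} (hA : A.IsHermitian) {r : ℝ}
    (hr : IsMinEigenvalue A r) :
    (A - (r : ℂ) • (1 : Matrix (Fin p) (Fin p) ℂ)).PosSemidef := by
  have hB : (A - (r : ℂ) • (1 : Matrix (Fin p) (Fin p) ℂ)).IsHermitian := by
    refine hA.sub ?_
    rw [Matrix.IsHermitian, Matrix.conjTranspose_smul, Matrix.conjTranspose_one]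
    simp
  rw [hB.posSemidef_iff_eigenvalues_nonneg]
  intro i
  have h1 : ((hB.eigenvalues i : ℝ) : ℂ) ∈
      spectrum ℂ (A - (r : ℂ) • (1 : Matrix (Fin p) (Fin p) ℂ)) := by
    rw [hB.spectrum_eq_image_range]
    exact ⟨_, ⟨i, rfl⟩, rfl⟩
  have h2 : r ≤ hB.eigenvalues i + r := hr.2 (by
    rw [Set.mem_ofPred_eq, Complex.ofReal_add, spectrum.add_mem_iff, Algebra.algebraMap_eq_smul_one,
      neg_add_eq_sub]
    exact h1)
  simp only [Pi.zero_apply]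
  linarith

lemma exists_isMinEigenvalue_ge (hp : 0 < p) {A : Matrix (Fin p) (Fin p) ℂ} {τ : ℝ}
    (hA : (A - (τ : ℂ) • (1 : Matrix (Fin p) (Fin p) ℂ)).PosSemidef) :
    A.IsHermitian ∧ ∃ r, IsMinEigenvalue A r ∧ τ ≤ r := by
  have hH : A.IsHermitian := by
    have h1 : ((τ : ℂ) • (1 : Matrix (Fin p) (Fin p) ℂ)).IsHermitian := by
      rw [Matrix.IsHermitian, Matrix.conjTranspose_smul, Matrix.conjTranspose_one]
      simp
    simpa using hA.isHermitian.add h1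
  refine ⟨hH, ?_⟩
  have : Nonempty (Fin p) := ⟨⟨0, hp⟩⟩
  obtain ⟨i, hi⟩ := Finite.exists_min hH.eigenvalues
  refine ⟨hH.eigenvalues i, ⟨?_, ?_⟩, ?_⟩
  · rw [Set.mem_ofPred_eq, hH.spectrum_eq_image_range]
    exact ⟨_, ⟨i, rfl⟩, rfl⟩
  · intro t ht
    rw [Set.mem_ofPred_eq, hH.spectrum_eq_image_range] at ht
    obtain ⟨_, ⟨j, rfl⟩, e⟩ := ht
    rw [← Complex.ofReal_injective e]
    exact hi j
  · have h1 : (((hH.eigenvalues i - τ : ℝ)) : ℂ) ∈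
        spectrum ℂ (A - (τ : ℂ) • (1 : Matrix (Fin p) (Fin p) ℂ)) := by
      rw [← neg_add_eq_sub ((τ : ℂ) • (1 : Matrix (Fin p) (Fin p) ℂ)),
        ← Algebra.algebraMap_eq_smul_one, ← spectrum.add_mem_iff, ← Complex.ofReal_add,
        sub_add_cancel, hH.spectrum_eq_image_range]
      exact ⟨_, ⟨i, rfl⟩, rfl⟩
    rw [hA.isHermitian.spectrum_eq_image_range] at h1
    obtain ⟨_, ⟨j, rfl⟩, e⟩ := h1
    have h2 := hA.eigenvalues_nonneg j
    have h3 : hA.isHermitian.eigenvalues j = hH.eigenvalues i - τ := Complex.ofReal_injective e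
    linarith

lemma entryNorm_conjTranspose (M : Matrix (Fin p) (Fin p) ℂ) {I : Finset (Fin p × Fin p)}
    (hI : ∀ jk, jk ∈ I ↔ jk.swap ∈ I) : entryNorm I M.conjTranspose = entryNorm I M := by
  unfold entryNorm
  congr 1
  refine Finset.sum_equiv (Equiv.prodComm _ _) (fun jk => hI jk) fun jk _ => ?_
  simp [Matrix.conjTranspose_apply]

/-- Conjugate transposition maps each `s_m` to itself and fixes `S`; with uniqueness, the minimizer
is Hermitian. -/
lemma objective_conjTranspose {S : Matrix (Fin p) (Fin p) ℂ} (hS : S.IsHermitian) (μ : ℝ)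
    (M : Matrix (Fin p) (Fin p) ℂ) : objective S 0 μ M.conjTranspose = objective S 0 μ M := by
  unfold objective penalty
  have h1 : M.conjTranspose - (S + ((0 : ℝ) : ℂ) • (1 : Matrix (Fin p) (Fin p) ℂ))
      = (M - (S + ((0 : ℝ) : ℂ) • (1 : Matrix (Fin p) (Fin p) ℂ))).conjTranspose := by
    simp [Matrix.conjTranspose_sub, hS.eq]
  rw [h1, entryNorm_conjTranspose _ (by simp)]
  congr 2
  refine Finset.sum_congr rfl fun l _ => ?_
  congr 1
  refine Finset.sum_congr rfl fun m _ => ?_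
  rw [entryNorm_conjTranspose]
  intro jk
  simp only [mem_sIdx, level, Prod.fst_swap, Prod.snd_swap]
  have : ((jk.1 : ℤ) - (jk.2 : ℤ)).natAbs = ((jk.2 : ℤ) - (jk.1 : ℤ)).natAbs := by omega
  rw [this]

/-- The diagonal is `s_p`, while the penalty stops at `l = p - 1`; a multiple of the identity is
thus invisible to it. -/
lemma objective_shift (S : Matrix (Fin p) (Fin p) ℂ) (τ μ : ℝ) (M : Matrix (Fin p) (Fin p) ℂ) :
    objective S τ μ M = objective S 0 μ (M - (τ : ℂ) • (1 : Matrix (Fin p) (Fin p) ℂ)) := by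
  unfold objective penalty
  have h1 : M - (S + (τ : ℂ) • (1 : Matrix (Fin p) (Fin p) ℂ)) =
      M - (τ : ℂ) • (1 : Matrix (Fin p) (Fin p) ℂ)
        - (S + ((0 : ℝ) : ℂ) • (1 : Matrix (Fin p) (Fin p) ℂ)) := by
    rw [Complex.ofReal_zero, zero_smul, add_zero]
    abel
  rw [h1]
  congr 2
  refine Finset.sum_congr rfl fun l hl => ?_
  congr 1
  refine Finset.sum_congr rfl fun m hm => ?_
  rw [Finset.mem_Icc] at hl hm
  congr 2
  unfold entryNorm
  congr 1
  refine Finset.sum_congr rfl fun jk hjk => ?_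
  have hne : jk.1 ≠ jk.2 := by
    intro h
    rw [mem_sIdx, level, h] at hjk
    simp at hjk
    omega
  simp [Matrix.one_apply_ne hne]

/-- Existence, uniqueness and symmetry hold always; only positivity needs an argument. -/
lemma mem_goodSet (hp : 0 < p) {S : Matrix (Fin p) (Fin p) ℂ} (hS : S.IsHermitian) {μ : ℝ}
    (hμ : 0 ≤ μ) (h : ∀ T : Matrix (Fin p) (Fin p) ℂ, T.IsHermitian → IsBandedEstimate S 0 μ T →
      T.PosSemidef) : S ∈ goodSet μ := by
  have hshift : ∀ (τ : ℝ) (M : Matrix (Fin p) (Fin p) ℂ), IsBandedEstimate S τ μ M ↔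
      IsBandedEstimate S 0 μ (M - (τ : ℂ) • (1 : Matrix (Fin p) (Fin p) ℂ)) := by
    intro τ M
    unfold IsBandedEstimate
    simp only [objective_shift S τ]
    exact ⟨fun h N => by simpa using h (N + (τ : ℂ) • (1 : Matrix (Fin p) (Fin p) ℂ)),
      fun h N => h _⟩
  have huniq : ∀ T U, IsBandedEstimate S 0 μ T → IsBandedEstimate S 0 μ U → T = U := by
    intro T U hT hU
    rw [isBandedEstimate_zero_iff] at hT hU
    have := lassoObj_min_unique groupWeight_nonneg hμ hT hU
    ext j k
    exact congrFun this (j, k)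
  obtain ⟨T₀, hT₀⟩ : ∃ T, IsBandedEstimate S 0 μ T := by
    obtain ⟨T, hT⟩ := exists_lassoObj_min (Finset.Icc 1 (p - 1)) groupWeight hμ (entries S)
    refine ⟨Matrix.of fun j k => T (j, k), ?_⟩
    rw [isBandedEstimate_zero_iff]
    exact hT
  intro τ
  refine ⟨⟨T₀ + (τ : ℂ) • (1 : Matrix (Fin p) (Fin p) ℂ), ?_, ?_⟩, ?_⟩
  · change IsBandedEstimate S τ μ _
    rw [hshift, add_sub_cancel_right]
    exact hT₀
  · intro M hM
    rw [← huniq _ _ ((hshift τ M).1 hM) hT₀, sub_add_cancel]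
  · intro M hM
    rw [hshift] at hM
    refine exists_isMinEigenvalue_ge hp (h _ ?_ hM)
    refine huniq _ _ (fun N => ?_) hM
    rw [objective_conjTranspose hS]
    exact hM N

lemma posSemidef_of_re_quadForm_nonneg {A : Matrix (Fin p) (Fin p) ℂ}
    (hA : A.IsHermitian) (h : ∀ u : Fin p → ℂ, 0 ≤ (star u ⬝ᵥ (A *ᵥ u)).re) : A.PosSemidef := by
  refine .of_dotProduct_mulVec_nonneg hA fun u => ?_
  rw [Complex.le_def]
  exact ⟨h u, (hA.im_star_dotProduct_mulVec_self u).symm⟩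

lemma re_quadForm_smul_one (r : ℝ) (u : Fin p → ℂ) :
    (star u ⬝ᵥ (((r : ℂ) • (1 : Matrix (Fin p) (Fin p) ℂ)) *ᵥ u)).re = r * ∑ j, ‖u j‖ ^ 2 := by
  rw [smul_mulVec, one_mulVec, dotProduct_smul, smul_eq_mul, Complex.re_ofReal_mul]
  congr 1
  rw [dotProduct, Complex.re_sum]
  refine Finset.sum_congr rfl fun j _ => ?_
  rw [Pi.star_apply, Complex.star_def, Complex.conj_mul', ← Complex.ofReal_pow, Complex.ofReal_re]

/-- Through this bound `σ² ≤ S₀`, so the lower bound on `σ²` limits the rate. -/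
lemma IsMinEigenvalue.le_norm_apply {A : Matrix (Fin p) (Fin p) ℂ} (hA : A.IsHermitian) {r : ℝ}
    (hr : IsMinEigenvalue A r) (j : Fin p) : r ≤ ‖A j j‖ := by
  have h := (Complex.le_def.1 ((hr.posSemidef_sub hA).diag_nonneg (i := j))).1
  simp at h
  exact h.trans (Complex.re_le_norm _)

/-- If the data are uniformly close to a covariance matrix with a banded signal-to-noise condition
and a large smallest eigenvalue, then the estimate is positive semidefinite. -/
lemma estimate_posSemidef {S Cov T : Matrix (Fin p) (Fin p) ℂ} (hS : S.PosSemidef)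
    (hCov : Cov.IsHermitian) {x r S₀ c' η : ℝ} (hx : 0 < x) (hr : 0 ≤ r) (hc' : 0 < c')
    (hbound : ∀ j k, ‖Cov j k‖ ≤ S₀) (hclose : ∀ j k, ‖S j k - Cov j k‖ ≤ x * r)
    {B L : ℕ} (hBL : B + 1 + L = p) {M₁ M₂ : ℝ} (hM₁ : M₁ ≤ η * L * r)
    (hsnr : BandedSNR Cov B M₁ M₂ c') {σsq C' : ℝ} (hσ : IsMinEigenvalue Cov σsq)
    (hσC : C' * L * r ≤ σsq) (hC'0 : 0 < C') (hC'1 : 10 * x * S₀ / c' ≤ C')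
    (hC'2 : 3 * (1 + 8 * (S₀ + c') / c') * x + 3 * η ≤ C')
    (hT : T.IsHermitian) (hmin : IsBandedEstimate S 0 (2 * x * r) T) : T.PosSemidef := by
  have hδ : 0 ≤ x * r := by positivity
  have hμ : 0 ≤ 2 * x * r := by positivity
  have hS₀ : 0 ≤ S₀ := (norm_nonneg _).trans (hbound ⟨0, by omega⟩ ⟨0, by omega⟩)
  have hout := entryNorm_outside_le hδ (by linarith) hclose hmin (by omega : B < p)
  have hdiag := estimate_diag hμ hmin
  -- For `L = 0` the lower bound on `σ²` carries no information, but then `M₁ = 0`, so `T` is the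
  -- diagonal of the positive semidefinite `S`.
  rcases Nat.eq_zero_or_pos L with hL | hL
  · have h0 : entryNorm (gIdx p B) T = 0 := by
      have h1 := hsnr.outside
      have h2 : M₁ ≤ 0 := by simpa [hL] using hM₁
      exact le_antisymm (by linarith) (entryNorm_nonneg _ _)
    have h1 : ∀ j k, j ≠ k → T j k = 0 := by
      intro j k hjk
      have h2 : ∑ jk ∈ gIdx p B, ‖T jk.1 jk.2‖ ^ 2 = 0 := by
        rw [← entryNorm_sq, h0]; simp
      rw [Finset.sum_eq_zero_iff_of_nonneg fun _ _ => sq_nonneg _] at h2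
      have h3 := h2 (j, k) (by
        rw [mem_gIdx, level]
        have : (j : ℕ) ≠ k := fun h => hjk (Fin.ext h)
        simp only
        omega)
      rwa [sq_eq_zero_iff, norm_eq_zero] at h3
    have h2 : T = diagonal fun j => S j j := by
      ext j k
      by_cases hjk : j = k
      · subst hjk; simp [hdiag]
      · rw [h1 j k hjk, diagonal_apply_ne _ hjk]
    rw [h2]
    exact PosSemidef.diagonal fun j => hS.diag_nonneg
  · have hL1 : (1 : ℝ) ≤ L := by exact_mod_cast hL
    have hσS : σsq ≤ S₀ := (hσ.le_norm_apply hCov ⟨0, by omega⟩).trans (hbound _ _)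
    -- From `C' r ≤ σ² ≤ S₀` and `10 x S₀ / c' ≤ C'`. The factor 10 is what `estimate_inBand` needs:
    -- `2(δ + 2μ) = 10 x r`.
    have hrate : x * r * 10 ≤ c' := by
      have h1 : C' * r ≤ S₀ := by
        have : C' * 1 * r ≤ C' * L * r := by gcongr
        linarith
      rw [div_le_iff₀ hc'] at hC'1
      rcases hS₀.eq_or_lt with h0 | h0
      · rw [← h0] at h1
        have : r = 0 := le_antisymm (nonpos_of_mul_nonpos_right h1 hC'0) hr
        rw [this]; linarith
      · have h2 : 10 * x * S₀ * r ≤ C' * c' * r := by gcongr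
        have h3 : S₀ * (x * r * 10) ≤ S₀ * c' := by
          have := mul_le_mul_of_nonneg_right h1 hc'.le
          linarith
        exact le_of_mul_le_mul_left h3 h0
    -- Noise `x r` plus shrinkage `μ (4 / c') ‖S‖`, with `μ = 2 x r` and `‖S‖ ≤ S₀ + c'` entrywise.
    set b := (1 + 8 * (S₀ + c') / c') * x * r with hb
    have hb0 : 0 ≤ b := by positivity
    have hin : ∀ jk : Fin p × Fin p, B < level jk → ‖(T - Cov) jk.1 jk.2‖ ≤ b := by
      intro jk hjk
      have h1 := estimate_inBand hδ hμ hc' (by linarith) hclose hmin hsnr.signal hjk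
      have h2 : ‖S jk.1 jk.2‖ ≤ S₀ + c' := by
        have h3 := norm_sub_norm_le (S jk.1 jk.2) (Cov jk.1 jk.2)
        have h4 := hclose jk.1 jk.2
        have h5 := hbound jk.1 jk.2
        linarith
      have h3 : 2 * x * r * (4 / c') * ‖S jk.1 jk.2‖ ≤ 2 * x * r * (4 / c') * (S₀ + c') := by
        gcongr
      have h4 : (T - Cov) jk.1 jk.2 = (T jk.1 jk.2 - S jk.1 jk.2)
          + (S jk.1 jk.2 - Cov jk.1 jk.2) := by simp
      rw [h4]
      refine (norm_add_le _ _).trans ((add_le_add (h1.trans h3) (hclose _ _)).trans (le_of_eq ?_))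
      rw [hb]
      ring
    have houtE : entryNorm (gIdx p B) (T - Cov) ≤ 3 * (η * L * r) := by
      have h1 := entryNorm_add_le (gIdx p B) T (-Cov)
      rw [entryNorm_neg, ← sub_eq_add_neg] at h1
      have := hsnr.outside
      linarith
    refine posSemidef_of_re_quadForm_nonneg hT fun u => ?_
    have hU : 0 ≤ ∑ j, ‖u j‖ ^ 2 := Finset.sum_nonneg fun _ _ => sq_nonneg _
    have hq := norm_quadForm_le hBL hb0 hin u
    have hpos := (hσ.posSemidef_sub hCov).re_dotProduct_nonneg u
    rw [sub_mulVec, dotProduct_sub] at hpos hq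
    simp only [map_sub] at hpos
    change 0 ≤ (star u ⬝ᵥ Cov *ᵥ u).re - (star u ⬝ᵥ ((σsq : ℂ) • 1) *ᵥ u).re at hpos
    rw [re_quadForm_smul_one] at hpos
    have h1 := (Complex.abs_re_le_norm _).trans hq
    rw [abs_le, Complex.sub_re] at h1
    have h2 : (2 * L + 1) * b + entryNorm (gIdx p B) (T - Cov) ≤ σsq := by
      refine le_trans ?_ hσC
      -- Here `L ≥ 1` turns the bandwidth `2L + 1` into a multiple of `L`.
      have e1 : (2 * L + 1) * b ≤ (3 * L) * b := by
        gcongr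
        linarith
      have e2 := mul_le_mul_of_nonneg_right hC'2 (by positivity : 0 ≤ L * r)
      rw [hb] at e1
      rw [hb]
      linarith
    have h3 := mul_le_mul_of_nonneg_right h2 hU
    linarith [h1.1]

end Deterministic

/-! ### Exponential moments and the Chernoff bound. -/

section Tail

/-- The exponential moment `𝔼 exp(g² / 4)` of a standard Gaussian variable. -/
noncomputable def gaussianSqMoment : ℝ≥0∞ :=
  ∫⁻ g, ENNReal.ofReal (Real.exp (g ^ 2 / 4)) ∂(gaussianReal 0 1)

/-- Against the Gaussian density, `exp(g² / 4)` leaves the integrable factor `exp(-g² / 4)`. -/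
lemma gaussianSqMoment_lt_top : gaussianSqMoment < ∞ := by
  unfold gaussianSqMoment
  rw [gaussianReal_of_var_ne_zero 0 one_ne_zero,
    lintegral_withDensity_eq_lintegral_mul _ (measurable_gaussianPDF 0 1) (by fun_prop)]
  have h : ∀ g : ℝ, (gaussianPDF 0 1 * fun g => ENNReal.ofReal (Real.exp (g ^ 2 / 4))) g
      = ENNReal.ofReal ((Real.sqrt (2 * Real.pi))⁻¹ * Real.exp (-(1 / 4) * g ^ 2)) := by
    intro g
    rw [Pi.mul_apply, gaussianPDF, ← ENNReal.ofReal_mul (gaussianPDFReal_nonneg _ _ _),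
      gaussianPDFReal, mul_assoc, ← Real.exp_add]
    congr 3
    · simp
    · simp only [NNReal.coe_one]
      ring
  simp_rw [h]
  exact ((integrable_exp_neg_mul_sq (by norm_num)).const_mul _).lintegral_lt_top

variable {Ω : Type*} [MeasurableSpace Ω]

/-- Sub-Gaussian variables have an exponential square moment. -/
lemma lintegral_exp_sq_le {ν : Measure Ω} [IsProbabilityMeasure ν] {Y : Ω → ℝ} (hY : Measurable Y)
    {c : ℝ≥0} (h : HasSubgaussianMGF Y c ν) {s : ℝ} (hs : 0 ≤ s) (hsc : s * c ≤ 1 / 4) :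
    ∫⁻ ω, ENNReal.ofReal (Real.exp (s * Y ω ^ 2)) ∂ν ≤ gaussianSqMoment := by
  have hsq : Real.sqrt (2 * s) ^ 2 = 2 * s := Real.sq_sqrt (by positivity)
  -- The square is linearized by an auxiliary Gaussian `g`; after Tonelli the sub-Gaussian bound
  -- applies for each fixed `g`.
  have h1 : ∀ ω, ENNReal.ofReal (Real.exp (s * Y ω ^ 2)) = ∫⁻ g,
      ENNReal.ofReal (Real.exp (Real.sqrt (2 * s) * Y ω * g)) ∂(gaussianReal 0 1) := by
    intro ω
    rw [← ofReal_integral_eq_lintegral_ofReal (integrable_exp_mul_gaussianReal _)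
      (Filter.Eventually.of_forall fun g => (Real.exp_pos _).le)]
    have := congrFun (mgf_fun_id_gaussianReal (μ := 0) (v := 1)) (Real.sqrt (2 * s) * Y ω)
    rw [mgf] at this
    rw [this, mul_pow, hsq]
    congr 2
    simp only [NNReal.coe_one]
    ring
  simp_rw [h1]
  rw [lintegral_lintegral_swap (by fun_prop)]
  refine lintegral_mono fun g => ?_
  have h2 : ∀ ω, Real.sqrt (2 * s) * Y ω * g = (Real.sqrt (2 * s) * g) * Y ω := fun ω => by ring
  simp_rw [h2]
  rw [← ofReal_integral_eq_lintegral_ofReal (h.integrable_exp_mul _)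
      (Filter.Eventually.of_forall fun g => (Real.exp_pos _).le)]
  refine ENNReal.ofReal_le_ofReal ((h.mgf_le _).trans (Real.exp_le_exp.2 ?_))
  rw [mul_pow, hsq]
  have := mul_le_mul_of_nonneg_right hsc (sq_nonneg g)
  linarith

/-- Convexity of `exp` avoids any independence: it combines real and imaginary parts, and later the
two coordinates of a product. -/
lemma lintegral_exp_half_add_le {ν : Measure Ω} {f g : Ω → ℝ} (hf : Measurable f)
    {D : ℝ≥0∞} (h1 : ∫⁻ ω, ENNReal.ofReal (Real.exp (f ω)) ∂ν ≤ D)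
    (h2 : ∫⁻ ω, ENNReal.ofReal (Real.exp (g ω)) ∂ν ≤ D) {k : Ω → ℝ}
    (hk : ∀ᵐ ω ∂ν, k ω ≤ (f ω + g ω) / 2) :
    ∫⁻ ω, ENNReal.ofReal (Real.exp (k ω)) ∂ν ≤ D := by
  have h3 : ∀ᵐ ω ∂ν, ENNReal.ofReal (Real.exp (k ω)) ≤
      2⁻¹ * (ENNReal.ofReal (Real.exp (f ω)) + ENNReal.ofReal (Real.exp (g ω))) := by
    filter_upwards [hk] with ω hω
    have e : (2⁻¹ : ℝ≥0∞) = ENNReal.ofReal (1 / 2) := by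
      rw [one_div, ENNReal.ofReal_inv_of_pos two_pos]; simp
    rw [← ENNReal.ofReal_add (Real.exp_pos _).le (Real.exp_pos _).le, e,
      ← ENNReal.ofReal_mul (by norm_num)]
    refine ENNReal.ofReal_le_ofReal ((Real.exp_le_exp.2 hω).trans ?_)
    have e1 : Real.exp ((f ω + g ω) / 2) = Real.exp (f ω / 2) * Real.exp (g ω / 2) := by
      rw [← Real.exp_add]; ring_nf
    have e2 : ∀ a : ℝ, Real.exp a = Real.exp (a / 2) ^ 2 := fun a => by
      rw [← Real.exp_nat_mul]; congr 1; push_cast; ring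
    rw [e1, e2 (f ω), e2 (g ω)]
    linarith [two_mul_le_add_sq (Real.exp (f ω / 2)) (Real.exp (g ω / 2))]
  refine (lintegral_mono_ae h3).trans ?_
  rw [lintegral_const_mul' _ _ (by simp), lintegral_add_left (by fun_prop)]
  calc 2⁻¹ * (_ + _) ≤ 2⁻¹ * (D + D) := by gcongr
    _ = D := by
      rw [← two_mul, ← mul_assoc, ENNReal.inv_mul_cancel (by simp) (by simp), one_mul]

lemma exp_le_one_add_add (y : ℝ) : Real.exp y ≤ 1 + y + y ^ 2 * Real.exp |y| := by
  have h := Complex.norm_exp_sub_sum_le_norm_mul_exp (y : ℂ) 2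
  simp only [Finset.sum_range_succ, Finset.sum_range_zero, zero_add, pow_zero, pow_one,
    Nat.factorial, Nat.cast_one, div_one, mul_one] at h
  have e : Complex.exp (y : ℂ) - (1 + (y : ℂ)) = ((Real.exp y - (1 + y) : ℝ) : ℂ) := by
    push_cast; ring
  rw [e, Complex.norm_real, Complex.norm_real, Real.norm_eq_abs, Real.norm_eq_abs, sq_abs] at h
  linarith [le_abs_self (Real.exp y - (1 + y))]

/-- The moment generating function of a sub-exponential variable near zero. -/
lemma mgf_le_of_lintegral_exp_abs {ν : Measure Ω} [IsProbabilityMeasure ν] {W : Ω → ℝ}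
    (hW : Measurable W) {s : ℝ} (hs : 0 < s) {D : ℝ≥0∞} (hD : D < ∞)
    (h : ∫⁻ ω, ENNReal.ofReal (Real.exp (s * |W ω|)) ∂ν ≤ D) {t : ℝ} (ht : 0 ≤ t)
    (hts : t ≤ s / 2) :
    Integrable (fun ω => Real.exp (t * W ω)) ν ∧
      mgf W ν t ≤ Real.exp (t * ∫ ω, W ω ∂ν + 8 * D.toReal / s ^ 2 * t ^ 2) := by
  have hint : Integrable (fun ω => Real.exp (s * |W ω|)) ν := by
    refine ⟨by fun_prop, ?_⟩
    rw [hasFiniteIntegral_iff_ofReal (Filter.Eventually.of_forall fun ω => (Real.exp_pos _).le)]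
    exact h.trans_lt hD
  have hDint : ∫ ω, Real.exp (s * |W ω|) ∂ν ≤ D.toReal := by
    rw [integral_eq_lintegral_of_nonneg_ae
      (Filter.Eventually.of_forall fun ω => (Real.exp_pos _).le) (by fun_prop)]
    exact ENNReal.toReal_mono hD.ne h
  have hWint : Integrable W ν := by
    refine (hint.const_mul s⁻¹).mono' (by fun_prop) (Filter.Eventually.of_forall fun ω => ?_)
    rw [Real.norm_eq_abs, inv_mul_eq_div, le_div_iff₀ hs]
    linarith [Real.add_one_le_exp (s * |W ω|)]
  have hexp : Integrable (fun ω => Real.exp (t * W ω)) ν := by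
    refine hint.mono' (by fun_prop) (Filter.Eventually.of_forall fun ω => ?_)
    rw [Real.norm_eq_abs, abs_of_pos (Real.exp_pos _), Real.exp_le_exp]
    calc t * W ω ≤ t * |W ω| := by have := le_abs_self (W ω); gcongr
      _ ≤ s * |W ω| := by gcongr; linarith
  refine ⟨hexp, ?_⟩
  have hpt : ∀ ω, Real.exp (t * W ω) ≤
      1 + t * W ω + 8 / s ^ 2 * t ^ 2 * Real.exp (s * |W ω|) := by
    intro ω
    refine (exp_le_one_add_add _).trans ?_
    -- With `u = s|W| / 2`, this is `u² / 2 ≤ exp u`. The other half of the exponent `s|W|` is left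
    -- for `exp |tW|`, as `t ≤ s / 2`.
    have h1 : W ω ^ 2 ≤ 8 / s ^ 2 * Real.exp (s * |W ω| / 2) := by
      have := Real.quadratic_le_exp_of_nonneg (x := s * |W ω| / 2) (by positivity)
      have h2 : s ^ 2 * W ω ^ 2 / 8 ≤ Real.exp (s * |W ω| / 2) := by
        rw [← sq_abs (W ω)]
        have : 0 ≤ s * |W ω| / 2 := by positivity
        nlinarith
      rw [div_mul_eq_mul_div, le_div_iff₀ (by positivity)]
      linarith
    have h2 : Real.exp |t * W ω| ≤ Real.exp (s * |W ω| / 2) := by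
      rw [Real.exp_le_exp, abs_mul, abs_of_nonneg ht]
      have := mul_le_mul_of_nonneg_right hts (abs_nonneg (W ω))
      linarith
    have h3 : (t * W ω) ^ 2 * Real.exp |t * W ω| ≤
        t ^ 2 * (8 / s ^ 2 * Real.exp (s * |W ω| / 2)) * Real.exp (s * |W ω| / 2) := by
      rw [mul_pow]
      gcongr
    have h4 : Real.exp (s * |W ω|) = Real.exp (s * |W ω| / 2) * Real.exp (s * |W ω| / 2) := by
      rw [← Real.exp_add]; ring_nf
    rw [h4]
    linarith
  have hint1 : Integrable (fun ω => 1 + t * W ω) ν :=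
    (integrable_const _).add (hWint.const_mul t)
  have hint2 : Integrable (fun ω => 8 / s ^ 2 * t ^ 2 * Real.exp (s * |W ω|)) ν :=
    hint.const_mul _
  calc mgf W ν t ≤ ∫ ω, (1 + t * W ω + 8 / s ^ 2 * t ^ 2 * Real.exp (s * |W ω|)) ∂ν :=
        integral_mono hexp (hint1.add hint2) hpt
    _ = 1 + t * ∫ ω, W ω ∂ν + 8 / s ^ 2 * t ^ 2 * ∫ ω, Real.exp (s * |W ω|) ∂ν := by
        rw [integral_add hint1 hint2, integral_add (integrable_const _) (hWint.const_mul t),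
          integral_const_mul, integral_const_mul]
        simp
    _ ≤ 1 + (t * ∫ ω, W ω ∂ν + 8 * D.toReal / s ^ 2 * t ^ 2) := by
        have : 8 / s ^ 2 * t ^ 2 * ∫ ω, Real.exp (s * |W ω|) ∂ν ≤ 8 / s ^ 2 * t ^ 2 * D.toReal := by
          gcongr
        linarith [show 8 / s ^ 2 * t ^ 2 * D.toReal = 8 * D.toReal / s ^ 2 * t ^ 2 by ring]
    _ ≤ _ := by
        rw [add_comm]
        exact Real.add_one_le_exp _

/-- The Chernoff bound for a sum of independent variables. -/
lemma measure_sum_ge_le_of_mgf_le {P : Measure Ω} [IsProbabilityMeasure P] {K : ℕ}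
    {V : Fin K → Ω → ℝ} (hV : ∀ i, AEMeasurable (V i) P) (hind : iIndepFun V P) {t m q ε : ℝ}
    (ht : 0 ≤ t) (hint : ∀ i, Integrable (fun ω => Real.exp (t * V i ω)) P)
    (hmgf : ∀ i, mgf (V i) P t ≤ Real.exp (t * m + q)) :
    P {ω | K * (m + ε) ≤ ∑ i, V i ω} ≤ ENNReal.ofReal (Real.exp (-(K * (t * ε - q)))) := by
  have hsum := hind.mgf_sum₀ (t := t) hV Finset.univ
  have hpos : 0 < mgf (∑ i, V i) P t := by
    rw [hsum]
    exact Finset.prod_pos fun i _ => mgf_pos (hint i)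
  have h1 := measure_ge_le_exp_mul_mgf (K * (m + ε)) ht (mgf_pos_iff.1 hpos)
  rw [← ofReal_measureReal]
  refine ENNReal.ofReal_le_ofReal ?_
  simp only [Finset.sum_apply] at h1
  refine h1.trans ?_
  have h2 : mgf (∑ i, V i) P t ≤ Real.exp (K * (t * m + q)) := by
    rw [hsum]
    calc ∏ i, mgf (V i) P t ≤ ∏ _i : Fin K, Real.exp (t * m + q) :=
          Finset.prod_le_prod (fun i _ => mgf_nonneg) fun i _ => hmgf i
      _ = Real.exp (K * (t * m + q)) := by
          rw [Finset.prod_const, Finset.card_univ, Fintype.card_fin, Real.exp_nat_mul]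
  calc Real.exp (-t * (K * (m + ε))) * mgf (∑ i, V i) P t
      ≤ Real.exp (-t * (K * (m + ε))) * Real.exp (K * (t * m + q)) := by gcongr
    _ = _ := by rw [← Real.exp_add]; ring_nf

end Tail

/-! ### Exponential moments of the coordinates. -/

section Model

variable {p : ℕ}

lemma SubGaussianModel.re_eq {ν : Measure (Fin p → ℂ)} {Cov : Matrix (Fin p) (Fin p) ℂ} {C : ℝ≥0}
    {S₀ : ℝ} (h : SubGaussianModel ν Cov C S₀) (j : Fin p) :
    (Cov j j).re = ∫ v, ‖v j‖ ^ 2 ∂ν := by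
  rw [← h.cov j j]
  have : ∀ v : Fin p → ℂ, v j * star (v j) = ((‖v j‖ ^ 2 : ℝ) : ℂ) := fun v => by
    rw [Complex.star_def, Complex.mul_conj']; push_cast; rfl
  simp_rw [this]
  rw [integral_complex_ofReal, Complex.ofReal_re]

lemma SubGaussianModel.isHermitian {ν : Measure (Fin p → ℂ)} {Cov : Matrix (Fin p) (Fin p) ℂ}
    {C : ℝ≥0} {S₀ : ℝ} (h : SubGaussianModel ν Cov C S₀) : Cov.IsHermitian := by
  ext j k
  rw [Matrix.conjTranspose_apply, ← h.cov j k, ← h.cov k j, Complex.star_def, ← integral_conj]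
  congr 1
  ext v
  simp [mul_comm]

/-- The squared moduli of the coordinates have a uniform exponential moment. -/
lemma SubGaussianModel.lintegral_exp_norm_sq_le {ν : Measure (Fin p → ℂ)} [IsProbabilityMeasure ν]
    {Cov : Matrix (Fin p) (Fin p) ℂ} {C : ℝ≥0} {S₀ : ℝ} (h : SubGaussianModel ν Cov C S₀) {s : ℝ}
    (hs : 0 ≤ s) (hsC : 2 * s * S₀ * (2 * C) ≤ 1 / 4) (j : Fin p) :
    ∫⁻ v, ENNReal.ofReal (Real.exp (s * ‖v j‖ ^ 2)) ∂ν ≤ gaussianSqMoment := by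
  have hS₀ : 0 ≤ S₀ := (norm_nonneg _).trans (h.bound j j)
  have hle : (Cov j j).re ≤ S₀ := (Complex.re_le_norm _).trans (h.bound j j)
  have hnn : 0 ≤ (Cov j j).re := by
    rw [h.re_eq]; exact integral_nonneg fun v => sq_nonneg _
  have hre := lintegral_exp_sq_le (by fun_prop) (h.subG_re j) (s := 2 * s * S₀) (by positivity)
    (by push_cast; exact hsC)
  have him := lintegral_exp_sq_le (by fun_prop) (h.subG_im j) (s := 2 * s * S₀) (by positivity)
    (by push_cast; exact hsC)
  refine lintegral_exp_half_add_le (by fun_prop) hre him ?_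
  -- A coordinate of variance zero vanishes almost surely; its normalization, a division by zero,
  -- gives no control of it.
  rcases hnn.eq_or_lt with h0 | h0
  · have h1 : ∀ᵐ v ∂ν, ‖v j‖ ^ 2 = 0 := by
      have h2 := h.re_eq j
      rw [← h0] at h2
      exact (integral_eq_zero_iff_of_nonneg (fun v => sq_nonneg _)
        ((h.memLp j).integrable_norm_pow two_ne_zero)).1 h2.symm
    filter_upwards [h1] with v hv
    rw [hv, mul_zero]
    positivity
  · refine Filter.Eventually.of_forall fun v => ?_
    have e : ∀ a : ℝ, s * a ^ 2 ≤ s * S₀ * (a / Real.sqrt (Cov j j).re) ^ 2 := by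
      intro a
      rw [div_pow, Real.sq_sqrt hnn, mul_assoc]
      refine mul_le_mul_of_nonneg_left ?_ hs
      rw [mul_div_assoc', le_div_iff₀ h0]
      nlinarith [sq_nonneg a]
    have h1 := e (v j).re
    have h2 := e (v j).im
    rw [Complex.sq_norm, Complex.normSq_apply]
    linarith

end Model

/-! ### Uniform concentration of the sample covariance matrix. -/

section Concentration

variable {p K : ℕ}

lemma scm_apply (x : Fin K → Fin p → ℂ) (j k : Fin p) :
    scm x j k = (K : ℂ)⁻¹ * ∑ i, x i j * star (x i k) := by
  simp [scm, Matrix.sum_apply, Matrix.vecMulVec_apply]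

open scoped ComplexOrder in
lemma scm_posSemidef (x : Fin K → Fin p → ℂ) : (scm x).PosSemidef := by
  unfold scm
  refine Matrix.PosSemidef.smul (Matrix.posSemidef_sum _ fun i _ =>
    Matrix.posSemidef_vecMulVec_self_star (x i)) ?_
  rw [← Complex.ofReal_natCast, ← Complex.ofReal_inv, Complex.zero_le_real]
  positivity

open scoped ComplexOrder in
lemma scm_isHermitian (x : Fin K → Fin p → ℂ) : (scm x).IsHermitian :=
  (scm_posSemidef x).isHermitian

/-- The upper tail of a rotated entry of the sample covariance matrix. -/
lemma SubGaussianModel.measure_entry_ge_le {ν : Measure (Fin p → ℂ)} [IsProbabilityMeasure ν]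
    {Cov : Matrix (Fin p) (Fin p) ℂ} {C : ℝ≥0} {S₀ : ℝ} (h : SubGaussianModel ν Cov C S₀) {s : ℝ}
    (hs : 0 < s) (hsC : 2 * s * S₀ * (2 * C) ≤ 1 / 4) (hK : 0 < K)
    {Ω : Type*} [MeasurableSpace Ω] {P : Measure Ω} [IsProbabilityMeasure P]
    {X : Fin K → Ω → Fin p → ℂ} (hX : ∀ i, HasLaw (X i) ν P) (hind : iIndepFun X P)
    {θ : ℂ} (hθ : ‖θ‖ = 1) (j k : Fin p) (ε : ℝ) {t : ℝ} (ht : 0 ≤ t) (hts : t ≤ s / 2) :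
    P {ω | ε ≤ (θ * (scm (fun i => X i ω) j k - Cov j k)).re} ≤
      ENNReal.ofReal (Real.exp
        (-(K * (t * ε - 8 * gaussianSqMoment.toReal / s ^ 2 * t ^ 2)))) := by
  set W : (Fin p → ℂ) → ℝ := fun v => (θ * (v j * star (v k))).re with hW
  have hWm : Measurable W := by
    have : Measurable fun z : ℂ => star z := continuous_star.measurable
    fun_prop
  have habs : ∀ v, s * |W v| ≤ (s * ‖v j‖ ^ 2 + s * ‖v k‖ ^ 2) / 2 := by
    intro v
    have h1 : |W v| ≤ ‖v j‖ * ‖v k‖ := by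
      refine (Complex.abs_re_le_norm _).trans (le_of_eq ?_)
      rw [norm_mul, norm_mul, hθ, one_mul, norm_star]
    have h2 := two_mul_le_add_sq ‖v j‖ ‖v k‖
    have h3 : |W v| ≤ (‖v j‖ ^ 2 + ‖v k‖ ^ 2) / 2 := by linarith
    have := mul_le_mul_of_nonneg_left h3 hs.le
    linarith
  have hexp : ∫⁻ v, ENNReal.ofReal (Real.exp (s * |W v|)) ∂ν ≤ gaussianSqMoment :=
    lintegral_exp_half_add_le (by fun_prop) (h.lintegral_exp_norm_sq_le hs.le hsC j)
      (h.lintegral_exp_norm_sq_le hs.le hsC k) (Filter.Eventually.of_forall habs)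
  obtain ⟨hint, hmgf⟩ := mgf_le_of_lintegral_exp_abs hWm hs gaussianSqMoment_lt_top hexp ht hts
  have hmean : ∫ v, W v ∂ν = (θ * Cov j k).re := by
    have hi : Integrable (fun v : Fin p → ℂ => v j * star (v k)) ν :=
      (h.memLp j).integrable_mul (h.memLp k).star
    have := integral_re (𝕜 := ℂ) (hi.const_mul θ)
    rw [integral_const_mul, h.cov] at this
    exact this
  have hexpm : AEStronglyMeasurable (fun v => Real.exp (t * W v)) ν := by fun_prop
  have hcher := measure_sum_ge_le_of_mgf_le (P := P) (V := fun i => W ∘ X i)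
    (fun i => hWm.comp_aemeasurable (hX i).aemeasurable) (hind.comp (fun _ => W) fun _ => hWm)
    (m := ∫ v, W v ∂ν) (ε := ε) ht
    (fun i => by
      have h1 := hint
      rw [← (hX i).map_eq] at h1
      exact h1.comp_aemeasurable (hX i).aemeasurable)
    (fun i => by
      rw [← mgf_map (hX i).aemeasurable (by rw [(hX i).map_eq]; exact hexpm), (hX i).map_eq]
      exact hmgf)
  refine (measure_mono fun ω hω => ?_).trans hcher
  have hK0 : (0 : ℝ) < K := by exact_mod_cast hK
  rw [Set.mem_ofPred_eq] at hω ⊢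
  have h1 : ∑ i, (W ∘ X i) ω = K * (θ * scm (fun i => X i ω) j k).re := by
    simp only [hW, Function.comp_apply]
    rw [← Complex.re_sum, ← Finset.mul_sum, scm_apply, ← Complex.re_ofReal_mul]
    congr 1
    have : (K : ℂ) ≠ 0 := by exact_mod_cast hK.ne'
    push_cast
    field_simp
  rw [h1, hmean]
  rw [mul_sub, Complex.sub_re] at hω
  refine mul_le_mul_of_nonneg_left ?_ hK0.le
  linarith

/-- The four real parts are `± Re z` and `± Im z`, and the largest is at least half of `|Re z| + |Im
z|`. Complex deviations thus reduce to four upper tails. -/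
lemma exists_rotation_re_ge (z : ℂ) :
    ∃ n : Fin 4, ‖z‖ / 2 ≤ (Complex.I ^ (n : ℕ) * z).re := by
  have h := Complex.norm_le_abs_re_add_abs_im z
  by_contra! hcon
  have h0 := hcon 0
  have h1 := hcon 1
  have h2 := hcon 2
  have h3 := hcon 3
  simp [pow_succ] at h0 h1 h2 h3
  rcases abs_cases z.re with ⟨e, _⟩ | ⟨e, _⟩ <;> rcases abs_cases z.im with ⟨e', _⟩ | ⟨e', _⟩ <;>
    linarith

lemma rate_nonneg (p K : ℕ) : 0 ≤ rate p K := Real.sqrt_nonneg _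

lemma natCast_mul_rate_sq (hp : 0 < p) (hK : 0 < K) : K * rate p K ^ 2 = Real.log p := by
  have hK0 : (0 : ℝ) < K := by exact_mod_cast hK
  have h1 : (1 : ℝ) ≤ p := by exact_mod_cast hp
  rw [rate, Real.sq_sqrt (div_nonneg (Real.log_nonneg h1) hK0.le)]
  field_simp

/-- The sample covariance matrix is uniformly close to the covariance matrix. -/
lemma SubGaussianModel.measure_compl_setA_le {ν : Measure (Fin p → ℂ)} [IsProbabilityMeasure ν]
    {Cov : Matrix (Fin p) (Fin p) ℂ} {C : ℝ≥0} {S₀ : ℝ} (h : SubGaussianModel ν Cov C S₀) {s : ℝ}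
    (hs : 0 < s) (hsC : 2 * s * S₀ * (2 * C) ≤ 1 / 4) (hp : 0 < p) (hK : 0 < K)
    {Ω : Type*} [MeasurableSpace Ω] {P : Measure Ω} [IsProbabilityMeasure P]
    {X : Fin K → Ω → Fin p → ℂ} (hX : ∀ i, HasLaw (X i) ν P) (hind : iIndepFun X P)
    {x a : ℝ} (ha : 0 ≤ a) (has : a * rate p K ≤ s / 2)
    (hx : 3 ≤ a * x / 2 - 8 * gaussianSqMoment.toReal / s ^ 2 * a ^ 2) :
    P {ω | scm (fun i => X i ω) ∈ setA K Cov x}ᶜ ≤ ENNReal.ofReal (4 / p) := by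
  have hp0 : (0 : ℝ) < p := by exact_mod_cast hp
  have hone : ∀ (j k : Fin p) (n : Fin 4),
      P {ω | x * rate p K / 2 ≤
        (Complex.I ^ (n : ℕ) * (scm (fun i => X i ω) j k - Cov j k)).re} ≤
      ENNReal.ofReal (1 / p ^ 3) := by
    intro j k n
    refine (h.measure_entry_ge_le hs hsC hK hX hind (by simp) j k _
      (mul_nonneg ha (rate_nonneg p K)) has).trans (ENNReal.ofReal_le_ofReal ?_)
    -- With `t = a * rate`, both terms scale as `K * rate² = log p`, so the tail is a power of `p`.
    have e1 : (K : ℝ) * (a * rate p K * (x * rate p K / 2)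
        - 8 * gaussianSqMoment.toReal / s ^ 2 * (a * rate p K) ^ 2)
        = Real.log p * (a * x / 2 - 8 * gaussianSqMoment.toReal / s ^ 2 * a ^ 2) := by
      rw [← natCast_mul_rate_sq hp hK]
      ring
    rw [e1]
    have h1 : 0 ≤ Real.log p := Real.log_nonneg (by exact_mod_cast hp)
    have h2 := mul_le_mul_of_nonneg_left hx h1
    calc Real.exp (-(Real.log p * (a * x / 2 - 8 * gaussianSqMoment.toReal / s ^ 2 * a ^ 2)))
        ≤ Real.exp (-((3 : ℕ) * Real.log p)) := by
          rw [Real.exp_le_exp]; push_cast; linarith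
      _ = 1 / p ^ 3 := by
          rw [Real.exp_neg, Real.exp_nat_mul, Real.exp_log hp0, one_div]
  have hsub : {ω | scm (fun i => X i ω) ∈ setA K Cov x}ᶜ ⊆
      ⋃ q : (Fin p × Fin p) × Fin 4, {ω | x * rate p K / 2 ≤
        (Complex.I ^ (q.2 : ℕ) * (scm (fun i => X i ω) q.1.1 q.1.2 - Cov q.1.1 q.1.2)).re} := by
    intro ω hω
    rw [Set.mem_compl_iff, Set.mem_ofPred_eq, setA, Set.mem_ofPred_eq] at hω
    push Not at hω
    obtain ⟨j, k, hjk⟩ := hω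
    obtain ⟨n, hn⟩ := exists_rotation_re_ge (scm (fun i => X i ω) j k - Cov j k)
    refine Set.mem_iUnion.2 ⟨((j, k), n), ?_⟩
    rw [Set.mem_ofPred_eq]
    linarith
  refine (measure_mono hsub).trans ((measure_iUnion_fintype_le _ _).trans ?_)
  refine (Finset.sum_le_sum fun q _ => hone q.1.1 q.1.2 q.2).trans (le_of_eq ?_)
  rw [Finset.sum_const, nsmul_eq_mul, Finset.card_univ, Fintype.card_prod, Fintype.card_prod,
    Fintype.card_fin, Fintype.card_fin, ← ENNReal.ofReal_natCast,
    ← ENNReal.ofReal_mul (by positivity)]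
  congr 1
  push_cast
  field_simp

end Concentration

end Banding

/-! ### Choice of the constants and conclusion. -/

theorem theorem5
    (C : ℝ≥0) (hC : 0 < C) (S₀ : ℝ) (hS₀ : 0 < S₀)
    (κ₀ κ₁ : ℝ) (hκ₀ : 0 < κ₀) (hκ₁ : 0 < κ₁)
    (c' : ℝ) (hc' : 0 < c') (η : ℝ) (hη : 0 ≤ η) :
    ∃ c₁ > (0 : ℝ), ∃ x₀ > (0 : ℝ), ∀ x > (0 : ℝ), ∃ C' > (0 : ℝ),
      ∀ (p K : ℕ), 0 < p → 0 < K →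
      κ₀ * Real.log K ≤ Real.log p → Real.log p ≤ κ₁ * K →
      ∀ (ν : Measure (Fin p → ℂ)) [IsProbabilityMeasure ν]
        (Cov : Matrix (Fin p) (Fin p) ℂ), Banding.SubGaussianModel ν Cov C S₀ →
      ∀ (B L : ℕ), B + 1 + L = p →
      ∀ (M₁ M₂ : ℝ), 0 ≤ M₁ → M₁ ≤ η * L * Banding.rate p K → 0 ≤ M₂ →
        Banding.BandedSNR Cov B M₁ M₂ c' →
      ∀ (σsq : ℝ), Banding.IsMinEigenvalue Cov σsq → C' * L * Banding.rate p K ≤ σsq →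
      ∀ (Ω : Type*) [MeasurableSpace Ω] (P : Measure Ω) [IsProbabilityMeasure P]
        (X : Fin K → Ω → Fin p → ℂ), (∀ i, HasLaw (X i) ν P) → iIndepFun X P →
        let S : Ω → Matrix (Fin p) (Fin p) ℂ := fun ω => Banding.scm fun i => X i ω
        let A : Set Ω := {ω | S ω ∈ Banding.setA K Cov x}
        let G : Set Ω := {ω | S ω ∈ Banding.goodSet (2 * x * Banding.rate p K)}
        P (A \ G) ≤ ENNReal.ofReal (c₁ / p) * P A ∧
        (x₀ ≤ x → P (A ∩ G)ᶜ ≤ ENNReal.ofReal (c₁ / p)) := by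
  set D := Banding.gaussianSqMoment.toReal with hD
  have hC0 : (0 : ℝ) < C := by exact_mod_cast hC
  -- Makes `2 s S₀ (2C)` equal to `1 / 4`, the limit allowed by the exponential moment bound.
  set s : ℝ := 1 / (16 * C * S₀) with hs
  have hs0 : 0 < s := by positivity
  -- Since `rate ≤ √κ₁`, the Chernoff parameter `a * rate` stays at most `s / 2`.
  set a : ℝ := s / (2 * Real.sqrt κ₁) with ha
  have hκ : 0 < Real.sqrt κ₁ := Real.sqrt_pos.2 hκ₁
  have ha0 : 0 < a := by positivity
  have hD0 : 0 ≤ D := ENNReal.toReal_nonneg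
  -- `x₀` solves `a x / 2 - 8 D a² / s² = 3`, which gives the exponent 3 in the tail `p⁻³`.
  refine ⟨4, by norm_num, 2 * (3 + 8 * D / s ^ 2 * a ^ 2) / a, by positivity, fun x hx => ?_⟩
  -- The sum of the two lower bounds on `C'` required by `estimate_posSemidef`.
  refine ⟨3 * (1 + 8 * (S₀ + c') / c') * x + 3 * η + 10 * x * S₀ / c', by positivity, ?_⟩
  intro p K hp hK _ hpK ν _ Cov hmodel B L hBL M₁ M₂ _ hM₁ _ hsnr σsq hσ hσC Ω _ P _ X hX hind
  have hr := Banding.rate_nonneg p K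
  have hAG : {ω | Banding.scm (fun i => X i ω) ∈ Banding.setA K Cov x} ⊆
      {ω | Banding.scm (fun i => X i ω) ∈ Banding.goodSet (2 * x * Banding.rate p K)} := by
    intro ω hω
    have hpsd := Banding.scm_posSemidef fun i => X i ω
    exact Banding.mem_goodSet hp (Banding.scm_isHermitian _) (by positivity) fun T hT hmin =>
      Banding.estimate_posSemidef hpsd hmodel.isHermitian hx hr hc' hmodel.bound hω hBL hM₁ hsnr
        hσ hσC (by positivity) (le_add_of_nonneg_left (by positivity))
        (le_add_of_nonneg_right (by positivity)) hT hmin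
  refine ⟨?_, fun hx₀ => ?_⟩
  · rw [Set.sdiff_eq_empty.2 hAG, measure_empty]
    exact bot_le
  · rw [Set.inter_eq_left.2 hAG]
    refine hmodel.measure_compl_setA_le hs0 (le_of_eq ?_) hp hK hX hind ha0.le ?_ ?_
    · rw [hs]; field_simp; norm_num
    · have hrate : Banding.rate p K ≤ Real.sqrt κ₁ := by
        refine Real.sqrt_le_sqrt ?_
        rw [div_le_iff₀ (by exact_mod_cast hK)]
        exact hpK
      calc a * Banding.rate p K ≤ a * Real.sqrt κ₁ := by gcongr
        _ = s / 2 := by rw [ha]; field_simp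
    · rw [div_le_iff₀ ha0] at hx₀
      linarith
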